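/- Let $n\in\mathbb N$, $n\ge 2$, $N=2^{\lfloor (n+1)/2\rfloor}$, and let $\alpha_1,\dots,\alpha_{n+1}$ be self-adjoint complex $N\times N$ matrices with $\alpha_j\alpha_k+\alpha_k\alpha_j=2\delta_{jk}I_N$ for $1\le j,k\le n+1$. Let $\eta(p)=h(|p|)$, $p\in\mathbb R^n$, where $h:[0,\infty)\to[0,1]$ satisfies $h(r)=r$ on $[0,1/2)$, $h$ is nondecreasing on $[1/2,1)$, $h(r)=1$ on $[1,\infty)$, and $\eta\in C^\infty(\mathbb R^n\setminus\{0\})$. In the Hilbert space $[L^2(\mathbb R^n)]^N$, let $Q=(Q_1,\dots,Q_n)$, where $Q_j$ is multiplication by $x_j$, and let $-i\nabla=(-i\partial_1,\dots,-i\partial_n)$ with distributional derivatives, each operator being taken on its maximal domain; functions of $-i\nabla$, in particular $\eta(-i\nabla)$ and $(-\Delta)^{-1}=|-i\nabla|^{-2}$, are defined through the Fourier transform $\mathcal F$ as multiplication by the corresponding function of the momentum variable, on the maximal domain. Write $\alpha\cdot(-i\nabla)=\sum_{j=1}^n\alpha_j(-i\partial_j)$. Let $$\mathcal D_0(\mathbb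 R^n)=\mathcal F^{-1}\big([C_0^\infty(\mathbb R^n\setminus\{0\})]^N\big),$$ that is, the space of functions whose Fourier transforms are smooth, compactly supported and vanish near $0$. Consider the operator $$A=\tfrac12\Big[(\alpha\cdot(-i\nabla))(-\Delta)^{-1}\eta(-i\nabla)\,((-i\nabla)\cdot Q)+(Q\cdot(-i\nabla))\,(-\Delta)^{-1}\eta(-i\nabla)\,(\alpha\cdot(-i\nabla))\Big],\qquad \operatorname{dom}(A)=\mathcal D_0(\mathbb R^n).$$ Then this expression is well defined on all of $\mathcal D_0(\mathbb R^n)$; the operator $A$ is essentially self-adjoint on $\mathcal D_0(\mathbb R^n)$ (it is densely defined and symmetric, and its closure $\overline A$ is self-adjoint); and $$[L^2_1(\mathbb R^n)]^N\subseteq\operatorname{dom}(\overline A),\qquad\text{where } L^2_1(\mathbb R^n)=\{f\in L^2(\mathbb R^n)\mid (1+|x|^2)^{1/2}f\in L^2(\mathbb R^n)\}.$$ -/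

import Mathlib

open MeasureTheory SchwartzMap
open scoped ContDiff FourierTransform LineDeriv

noncomputable section

namespace MasslessDirac

/-- Euclidean space `ℝⁿ`. -/
abbrev E (n : ℕ) : Type := EuclideanSpace ℝ (Fin n)

/-- The Hilbert space `[L²(ℝⁿ)]^N`, realised as `L²(ℝⁿ; ℂ^N)` with Lebesgue measure. -/
abbrev L2 (n N : ℕ) : Type :=
  Lp (EuclideanSpace ℂ (Fin N)) 2 (volume : Measure (E n))

section Abstract

variable {H : Type*} [NormedAddCommGroup H] [InnerProductSpace ℂ H]

/-- The product `S T` of two unbounded operators, on its natural (maximal) domain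
`{x ∈ dom T | T x ∈ dom S}`. -/
def opMul (S T : H →ₗ.[ℂ] H) : H →ₗ.[ℂ] H where
  domain := (S.domain.comap T.toFun).map T.domain.subtype
  toFun :=
    { toFun := fun x => S ⟨T ⟨x.1, by
          obtain ⟨y, _, hy⟩ := x.2
          exact hy ▸ y.2⟩, by
          obtain ⟨x, y, hy, rfl⟩ := x
          exact hy⟩
      map_add' := fun x y => by
        rw [← S.map_add]
        congr 1
        apply Subtype.ext
        exact T.map_add ⟨x.1, _⟩ ⟨y.1, _⟩
      map_smul' := fun c x => by
        rw [RingHom.id_apply, ← S.map_smul]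
        congr 1
        apply Subtype.ext
        exact T.map_smul c ⟨x.1, _⟩ }

/-- A densely defined symmetric operator is essentially self-adjoint if its closure is
self-adjoint. -/
def IsEssentiallySelfAdjoint [CompleteSpace H] (T : H →ₗ.[ℂ] H) : Prop :=
  Dense (T.domain : Set H) ∧ T.IsFormalAdjoint T ∧ IsSelfAdjoint T.closure

end Abstract

section Operators

variable {n N : ℕ}

/-- The maximal operator of multiplication by the scalar function `m` in `[L²(ℝⁿ)]^N`:
its domain is `{f ∈ L² | m f ∈ L²}`. The graph consists of the pairs `(f, g)` in `L² × L²`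
such that `g = m f` almost everywhere. -/
def mulOp (m : E n → ℂ) : L2 n N →ₗ.[ℂ] L2 n N :=
  Submodule.toLinearPMap
    { carrier := {fg : L2 n N × L2 n N | ∀ᵐ x, fg.2 x = m x • fg.1 x}
      zero_mem' := by
        change ∀ᵐ x, (0 : L2 n N) x = m x • (0 : L2 n N) x
        filter_upwards [Lp.coeFn_zero (EuclideanSpace ℂ (Fin N)) 2 (volume : Measure (E n))]
          with x hx
        rw [hx, Pi.zero_apply, smul_zero]
      add_mem' := by
        rintro ⟨f, g⟩ ⟨f', g'⟩ h h'
        change ∀ᵐ x, (g + g') x = m x • (f + f') x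
        filter_upwards [Lp.coeFn_add f f', Lp.coeFn_add g g', h, h'] with x h₁ h₂ h₃ h₄
        rw [h₁, h₂, Pi.add_apply, Pi.add_apply, h₃, h₄, smul_add]
      smul_mem' := by
        rintro c ⟨f, g⟩ h
        change ∀ᵐ x, (c • g) x = m x • (c • f) x
        filter_upwards [Lp.coeFn_smul c f, Lp.coeFn_smul c g, h] with x h₁ h₂ h₃
        rw [h₁, h₂, Pi.smul_apply, Pi.smul_apply, h₃, smul_comm] }

/-- The relation defining `mulOp` is the graph of an operator. -/
theorem mem_graph_mulOp (m : E n → ℂ) (f g : L2 n N) :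
    (f, g) ∈ (mulOp m).graph ↔ ∀ᵐ x, g x = m x • f x := by
  rw [mulOp, Submodule.toLinearPMap_graph_eq]
  · rfl
  · rintro ⟨f, g⟩ h h0
    change f = 0 at h0
    subst h0
    change ∀ᵐ x, g x = m x • (0 : L2 n N) x at h
    refine (Lp.eq_zero_iff_ae_eq_zero).mpr ?_
    filter_upwards [h, Lp.coeFn_zero (EuclideanSpace ℂ (Fin N)) 2 (volume : Measure (E n))]
      with x hx h0
    rw [hx, h0, Pi.zero_apply, smul_zero]

/-- `Q_j`: multiplication by the `j`-th coordinate, on its maximal domain. -/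
def position (j : Fin n) : L2 n N →ₗ.[ℂ] L2 n N :=
  mulOp fun x => ((x j : ℝ) : ℂ)

/-- `-i ∂_j` with distributional derivatives, on its maximal domain
`{f ∈ L² | ∂_j f ∈ L²}`. The graph consists of the pairs `(f, g)` in `L² × L²` such that
`g = -i ∂_j f` as tempered distributions. -/
def momentum (j : Fin n) : L2 n N →ₗ.[ℂ] L2 n N :=
  Submodule.toLinearPMap
    { carrier := {fg : L2 n N × L2 n N |
        (fg.2 : 𝓢'(E n, EuclideanSpace ℂ (Fin N))) =
          (-Complex.I) • ∂_{EuclideanSpace.single j (1 : ℝ)}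
            (fg.1 : 𝓢'(E n, EuclideanSpace ℂ (Fin N)))}
      zero_mem' := by
        simp only [Set.mem_ofPred_eq, Prod.fst_zero, Prod.snd_zero,
          ← Lp.toTemperedDistributionCLM_apply, map_zero,
          ← LineDeriv.lineDerivOpCLM_apply (R := ℂ), smul_zero]
      add_mem' := fun {a b} ha hb => by
        simp only [Set.mem_ofPred_eq, Prod.fst_add, Prod.snd_add,
          ← Lp.toTemperedDistributionCLM_apply, map_add,
          ← LineDeriv.lineDerivOpCLM_apply (R := ℂ), smul_add] at ha hb ⊢
        rw [ha, hb]
      smul_mem' := fun c a ha => by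
        simp only [Set.mem_ofPred_eq, Prod.smul_fst, Prod.smul_snd,
          ← Lp.toTemperedDistributionCLM_apply, map_smul,
          ← LineDeriv.lineDerivOpCLM_apply (R := ℂ)] at ha ⊢
        rw [ha, smul_comm] }

/-- The relation defining `momentum` is the graph of an operator. -/
theorem mem_graph_momentum (j : Fin n) (f g : L2 n N) :
    (f, g) ∈ (momentum j).graph ↔
      (g : 𝓢'(E n, EuclideanSpace ℂ (Fin N))) =
        (-Complex.I) • ∂_{EuclideanSpace.single j (1 : ℝ)}
          (f : 𝓢'(E n, EuclideanSpace ℂ (Fin N))) := by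
  rw [momentum, Submodule.toLinearPMap_graph_eq]
  · rfl
  · rintro ⟨f, g⟩ h h0
    change f = 0 at h0
    subst h0
    change (g : 𝓢'(E n, EuclideanSpace ℂ (Fin N))) =
        (-Complex.I) • ∂_{EuclideanSpace.single j (1 : ℝ)}
          ((0 : L2 n N) : 𝓢'(E n, EuclideanSpace ℂ (Fin N))) at h
    simp only [← Lp.toTemperedDistributionCLM_apply, map_zero,
      ← LineDeriv.lineDerivOpCLM_apply (R := ℂ), smul_zero] at h
    have hk := Lp.ker_toTemperedDistributionCLM_eq_bot (E := E n)
      (F := EuclideanSpace ℂ (Fin N)) (μ := volume) (p := 2)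
    exact LinearMap.ker_eq_bot'.mp hk g h

/-- The Fourier transform of `[L²(ℝⁿ)]^N`, acting componentwise, with kernel
`exp (-2 π i x · ξ)`. -/
abbrev fourierL2 : L2 n N ≃ₗᵢ[ℂ] L2 n N :=
  Lp.fourierTransformₗᵢ (E n) (EuclideanSpace ℂ (Fin N))

/-- The function `m(-i∇)` of the commuting self-adjoint operators `-i ∂_1, …, -i ∂_n`,
on its maximal domain. In the present normalisation of the Fourier transform, `-i ∂_j` becomes
multiplication by `2 π ξ_j`, so `m(-i∇) = 𝓕⁻¹ m(2 π ξ) 𝓕`. -/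
def momentumFn (m : E n → ℂ) : L2 n N →ₗ.[ℂ] L2 n N :=
  (fourierL2 (n := n) (N := N)).symm.toLinearEquiv.toLinearMap.compPMap
    (opMul (mulOp fun ξ => m ((2 * Real.pi) • ξ))
      ((fourierL2 (n := n) (N := N)).toLinearEquiv.toLinearMap.toPMap ⊤))

/-- `(-Δ)⁻¹`, the function `|p|⁻²` of `p = -i∇` (so an unbounded operator). -/
def invNegLaplacian : L2 n N →ₗ.[ℂ] L2 n N :=
  momentumFn fun p => (((‖p‖ ^ 2)⁻¹ : ℝ) : ℂ)

/-- A constant `N × N` matrix acting in `[L²(ℝⁿ)]^N`. -/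
def matrixOp (M : Matrix (Fin N) (Fin N) ℂ) : L2 n N →L[ℂ] L2 n N :=
  (Matrix.toEuclideanCLM (n := Fin N) (𝕜 := ℂ) M).compLpL 2 volume

/-- `α · (-i∇) = ∑_j α_j (-i ∂_j)`. Only the first `n` of the `n + 1` matrices occur. -/
def dirac (α : Fin (n + 1) → Matrix (Fin N) (Fin N) ℂ) : L2 n N →ₗ.[ℂ] L2 n N :=
  ∑ j : Fin n, (matrixOp (n := n) (α j.castSucc)).toLinearMap.compPMap (momentum j)

/-- `(-i∇) · Q = ∑_j (-i ∂_j) Q_j`. -/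
def momentumDotPosition : L2 n N →ₗ.[ℂ] L2 n N :=
  ∑ j : Fin n, opMul (momentum j) (position j)

/-- `Q · (-i∇) = ∑_j Q_j (-i ∂_j)`. -/
def positionDotMomentum : L2 n N →ₗ.[ℂ] L2 n N :=
  ∑ j : Fin n, opMul (position j) (momentum j)

/-- The operator expression
`½ [(α·(-i∇)) (-Δ)⁻¹ η(-i∇) ((-i∇)·Q) + (Q·(-i∇)) (-Δ)⁻¹ η(-i∇) (α·(-i∇))]`,
on its natural domain. -/
def conjugateExpr (α : Fin (n + 1) → Matrix (Fin N) (Fin N) ℂ) (η : E n → ℝ) :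
    L2 n N →ₗ.[ℂ] L2 n N :=
  (1 / 2 : ℂ) •
    (opMul (dirac α) (opMul invNegLaplacian
        (opMul (momentumFn fun p => (η p : ℂ)) momentumDotPosition)) +
      opMul positionDotMomentum (opMul invNegLaplacian
        (opMul (momentumFn fun p => (η p : ℂ)) (dirac α))))

/-- `𝒟₀(ℝⁿ) = 𝓕⁻¹ ([C₀^∞(ℝⁿ \ {0})]^N)`. -/
def D0 (n N : ℕ) : Submodule ℂ (L2 n N) where
  carrier := {f | ∃ g : E n → EuclideanSpace ℂ (Fin N), ContDiff ℝ ∞ g ∧ HasCompactSupport g ∧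
    (0 : E n) ∉ tsupport g ∧ (fourierL2 f : E n → EuclideanSpace ℂ (Fin N)) =ᵐ[volume] g}
  zero_mem' := by
    refine ⟨0, contDiff_const, HasCompactSupport.zero, by simp [tsupport], ?_⟩
    rw [map_zero]
    exact Lp.coeFn_zero _ _ _
  add_mem' := by
    rintro f₁ f₂ ⟨g₁, hs₁, hc₁, h0₁, he₁⟩ ⟨g₂, hs₂, hc₂, h0₂, he₂⟩
    refine ⟨g₁ + g₂, hs₁.add hs₂, hc₁.add hc₂,
      fun h => (tsupport_add g₁ g₂ h).elim h0₁ h0₂, ?_⟩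
    rw [map_add]
    exact (Lp.coeFn_add _ _).trans (he₁.add he₂)
  smul_mem' := by
    rintro c f ⟨g, hs, hc, h0, he⟩
    refine ⟨c • g, hs.const_smul c, hc.smul_left (f := fun _ => c),
      fun h => h0 (tsupport_smul_subset_right (fun _ => c) g h), ?_⟩
    rw [map_smul]
    exact (Lp.coeFn_smul _ _).trans (he.const_smul c)

/-- The conjugate operator `A`, with `dom A = 𝒟₀(ℝⁿ)` (as soon as `𝒟₀(ℝⁿ)` lies in the natural
domain of the expression). -/
def conjugateOp (α : Fin (n + 1) → Matrix (Fin N) (Fin N) ℂ) (η : E n → ℝ) :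
    L2 n N →ₗ.[ℂ] L2 n N :=
  (conjugateExpr α η).domRestrict (D0 n N)

/-- The weighted space `[L²_s(ℝⁿ)]^N = {f ∈ L² | ⟨x⟩^s f ∈ L²}`, `⟨x⟩ = (1 + |x|²)^{1/2}`. -/
def weightedL2 (n N : ℕ) (s : ℝ) : Submodule ℂ (L2 n N) :=
  (mulOp (n := n) (N := N) fun x => ((Real.sqrt (1 + ‖x‖ ^ 2) ^ s : ℝ) : ℂ)).domain

end Operators

/-- `N × N` matrices that are self-adjoint and satisfy `α_j α_k + α_k α_j = 2 δ_{jk} I`. -/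
def IsDiracSystem {ι : Type*} [DecidableEq ι] {N : ℕ}
    (α : ι → Matrix (Fin N) (Fin N) ℂ) : Prop :=
  (∀ j, (α j).IsHermitian) ∧
    ∀ j k, α j * α k + α k * α j = if j = k then 2 • (1 : Matrix (Fin N) (Fin N) ℂ) else 0

/-- `η(p) = h(|p|)` where `h : [0,∞) → [0,1]` equals `r` on `[0,1/2)`, is nondecreasing on
`[1/2,1)`, equals `1` on `[1,∞)`, and `η` is smooth on `ℝⁿ \ {0}`. -/
structure IsCutoff {n : ℕ} (η : E n → ℝ) (h : ℝ → ℝ) : Prop where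
  radial : ∀ p, η p = h ‖p‖
  mem_Icc : ∀ r, 0 ≤ r → h r ∈ Set.Icc (0 : ℝ) 1
  eq_self : ∀ r ∈ Set.Ico (0 : ℝ) (1 / 2), h r = r
  monotone : MonotoneOn h (Set.Ico (1 / 2) 1)
  eq_one : ∀ r, 1 ≤ r → h r = 1
  smooth : ContDiffOn ℝ ∞ η {0}ᶜ

end MasslessDirac

end

/-!
On the Fourier side, with `p = 2πξ`, the operator `A` is a first order system whose coefficients
point in the radial direction. Put `c ξ = η (2πξ) / (2π|ξ|)` (the `profile`, a function of
`log |ξ|`) and let `σ ξ = α · ξ / |ξ|` be the `directionMatrix`. The anticommutation relations make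
`σ` a self-adjoint involution, and `σ` is constant along rays, hence is not differentiated by
`ξ · ∇`. It follows (`HasSymbol.conjugateExpr`) that

  `A = i σ R`,  `R = c ξ · ∇ + (ξ · ∇ c + n c) / 2`,

where `σ` and `R` commute and `R` (`radialGenerator`) is the skew-symmetric generator of the
half-density transport along the flow of the vector field `c ξ`. In the variable `y = log |ξ|` this
vector field is `C y ∂_y` with `0 < C ≤ 2`, so that the flow exists for all times, is smooth, and
maps test functions supported away from the origin to such functions (`transport`).

Essential self-adjointness is the triviality of the deficiency subspaces. Let `u` be orthogonal to
the range of `A ± i` and let `g` be a test function with `σ g = ε g`, `ε = ±1`. The transported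
functions `U_t g` have the same property, and `φ t = ⟪u, U_t g⟫` satisfies `φ' = ±φ`, whereas `φ` is
bounded since skew-symmetry of `R` makes `‖U_t g‖` constant. So `φ = 0`
(`integral_inner_eq_zero_of_eigen`), and as every test function is a sum of two such `g`, `u = 0`
(`eq_zero_of_inner_conjugateOp`). The basic criterion `closure_eq_adjoint` then identifies the
closure of `A` with its adjoint.

The weighted space therefore only has to be found in the domain of the adjoint. There it lies
because `A = ∑_j Q_j B_j - B` on `𝒟₀` with bounded Fourier multipliers `B_j` and `B`
(`exists_decomposition`): the coefficients `c ξ_j σ` are bounded, and so is their divergence.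
-/

noncomputable section

namespace MasslessDirac

/-! ### Products of unbounded operators and the criterion for essential self-adjointness -/

section Abstract

variable {H : Type*} [NormedAddCommGroup H] [InnerProductSpace ℂ H]

theorem mem_graph_opMul {S T : H →ₗ.[ℂ] H} {x y z : H} (hT : (x, y) ∈ T.graph)
    (hS : (y, z) ∈ S.graph) : (x, z) ∈ (opMul S T).graph := by
  obtain ⟨a, ha, hb⟩ := T.mem_graph_iff.1 hT
  obtain ⟨b, hc, hd⟩ := S.mem_graph_iff.1 hS
  dsimp only at ha hb hc hd
  subst ha
  have hy : T a ∈ S.domain := by rw [hb, ← hc]; exact b.2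
  refine (opMul S T).mem_graph_iff.2 ⟨⟨a, a, hy, rfl⟩, rfl, ?_⟩
  change S ⟨T ⟨a, _⟩, _⟩ = z
  rw [← hd]
  congr 1
  exact Subtype.ext (hb.trans hc.symm)

theorem mem_graph_add {S T : H →ₗ.[ℂ] H} {x y z : H} (hS : (x, y) ∈ S.graph)
    (hT : (x, z) ∈ T.graph) : (x, y + z) ∈ (S + T).graph := by
  obtain ⟨a, rfl, rfl⟩ := S.mem_graph_iff.1 hS
  obtain ⟨b, hb, rfl⟩ := T.mem_graph_iff.1 hT
  have hab : (b : H) = a := hb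
  refine (S + T).mem_graph_iff.2 ⟨⟨a, a.2, show (a : H) ∈ T.domain from hab ▸ b.2⟩, rfl, ?_⟩
  rw [LinearPMap.add_apply]
  congr 2
  exact Subtype.ext hb.symm

theorem mem_graph_smul {T : H →ₗ.[ℂ] H} {x y : H} (c : ℂ) (hT : (x, y) ∈ T.graph) :
    (x, c • y) ∈ (c • T).graph := by
  obtain ⟨a, rfl, rfl⟩ := T.mem_graph_iff.1 hT
  exact (c • T).mem_graph_iff.2 ⟨a, rfl, rfl⟩

theorem mem_graph_sum {ι : Type*} (s : Finset ι) {T : ι → H →ₗ.[ℂ] H} {x : H} {y : ι → H}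
    (h : ∀ j ∈ s, (x, y j) ∈ (T j).graph) : (x, ∑ j ∈ s, y j) ∈ (∑ j ∈ s, T j).graph := by
  classical
  induction s using Finset.induction_on with
  | empty =>
    exact (0 : H →ₗ.[ℂ] H).mem_graph_iff.2 ⟨⟨x, trivial⟩, rfl, rfl⟩
  | insert a s ha ih =>
    rw [Finset.sum_insert ha, Finset.sum_insert ha]
    exact mem_graph_add (h a (Finset.mem_insert_self _ _))
      (ih fun j hj => h j (Finset.mem_insert_of_mem hj))

theorem mem_graph_compPMap (S : H →ₗ[ℂ] H) {T : H →ₗ.[ℂ] H} {x y : H}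
    (hT : (x, y) ∈ T.graph) : (x, S y) ∈ (S.compPMap T).graph := by
  obtain ⟨a, rfl, rfl⟩ := T.mem_graph_iff.1 hT
  exact (S.compPMap T).mem_graph_iff.2 ⟨a, rfl, rfl⟩

variable [CompleteSpace H]

local notation "⟪" x ", " y "⟫" => inner ℂ x y

theorem isClosable_of_isFormalAdjoint {T : H →ₗ.[ℂ] H} (hd : Dense (T.domain : Set H))
    (hs : T.IsFormalAdjoint T) : T.IsClosable :=
  (LinearPMap.IsClosed.isClosable (T.adjoint_isClosed hd)).leIsClosable (hs.le_adjoint hd)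

/-- For a closed symmetric relation `G`, `(x, y) ↦ y - ix` is bounded below, since
`‖y - ix‖² = ‖x‖² + ‖y‖²`; its range is therefore closed, and it is everything as soon as the
orthogonal complement is trivial. -/
theorem exists_mem_sub_I_smul_eq {G : Submodule ℂ (H × H)} (hG : IsClosed (G : Set (H × H)))
    (hsymm : ∀ p ∈ G, ∀ q ∈ G, ⟪p.2, q.1⟫ = ⟪p.1, q.2⟫)
    (hker : ∀ u : H, (∀ p ∈ G, ⟪u, p.2 - Complex.I • p.1⟫ = 0) → u = 0) (v : H) :
    ∃ p ∈ G, p.2 - Complex.I • p.1 = v := by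
  let L : G →L[ℂ] H :=
    (ContinuousLinearMap.snd ℂ H H - Complex.I • ContinuousLinearMap.fst ℂ H H).comp G.subtypeL
  have hL (p : G) : L p = p.1.2 - Complex.I • p.1.1 := rfl
  have hnorm (p : G) : ‖(p : H × H)‖ ≤ ‖L p‖ := by
    have h1 : ‖L p‖ ^ 2 = ‖p.1.2‖ ^ 2 + ‖p.1.1‖ ^ 2 := by
      have hre : (⟪p.1.2, Complex.I • p.1.1⟫).re = 0 := by
        have := hsymm p p.2 p p.2
        rw [inner_smul_right]
        have him : (⟪p.1.2, p.1.1⟫).im = 0 := by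
          rw [← Complex.conj_eq_iff_im, inner_conj_symm, this]
        simp [him]
      rw [hL, norm_sub_sq (𝕜 := ℂ)]
      simp [hre, norm_smul]
    have h2 : 0 ≤ ‖p.1.2‖ := norm_nonneg _
    have h3 : 0 ≤ ‖p.1.1‖ := norm_nonneg _
    rw [Prod.norm_def]
    refine max_le (abs_le_of_sq_le_sq' ?_ (norm_nonneg _)).2
      (abs_le_of_sq_le_sq' ?_ (norm_nonneg _)).2 <;> nlinarith
  have : CompleteSpace G := hG.completeSpace_coe
  have hanti : AntilipschitzWith 1 L :=
    ContinuousLinearMap.antilipschitz_of_bound L fun p => by simpa using hnorm p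
  have hclosed : IsClosed (L.range : Set H) := by
    simpa using! hanti.isClosed_range L.uniformContinuous
  have : CompleteSpace L.range := hclosed.completeSpace_coe
  have htop : L.range = ⊤ := by
    rw [← Submodule.orthogonal_eq_bot_iff, Submodule.eq_bot_iff]
    intro u hu
    refine hker u fun p hp => ?_
    rw [Submodule.mem_orthogonal'] at hu
    exact hu _ ⟨⟨p, hp⟩, rfl⟩
  obtain ⟨p, hp⟩ : v ∈ L.range := htop ▸ Submodule.mem_top
  exact ⟨p, p.2, hp⟩

/-- The basic criterion for essential self-adjointness: if both deficiency subspaces of a densely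
defined symmetric operator are trivial, its closure is its adjoint. -/
theorem closure_eq_adjoint {T : H →ₗ.[ℂ] H} (hd : Dense (T.domain : Set H))
    (hs : T.IsFormalAdjoint T)
    (hplus : ∀ u : H, (∀ x : T.domain, ⟪u, T x + Complex.I • (x : H)⟫ = 0) → u = 0)
    (hminus : ∀ u : H, (∀ x : T.domain, ⟪u, T x - Complex.I • (x : H)⟫ = 0) → u = 0) :
    T.closure = T.adjoint := by
  have hcl := isClosable_of_isFormalAdjoint hd hs
  have hle : T.closure.graph ≤ T.adjoint.graph := by
    rw [← hcl.graph_closure_eq_closure_graph]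
    exact Submodule.topologicalClosure_minimal _ (LinearPMap.le_graph_of_le (hs.le_adjoint hd))
      (T.adjoint_isClosed hd)
  have hadj : ∀ p ∈ T.adjoint.graph, ∀ x : T.domain, ⟪p.2, (x : H)⟫ = ⟪p.1, T x⟫ := by
    rintro ⟨u, v⟩ hp x
    obtain ⟨a, rfl, rfl⟩ := T.adjoint.mem_graph_iff.1 hp
    exact LinearPMap.adjoint_isFormalAdjoint hd a x
  have hsymm : ∀ p ∈ T.closure.graph, ∀ q ∈ T.closure.graph, ⟪p.2, q.1⟫ = ⟪p.1, q.2⟫ := by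
    intro p hp q hq
    rw [← hcl.graph_closure_eq_closure_graph] at hq
    have hclosed : IsClosed {q : H × H | ⟪p.2, q.1⟫ = ⟪p.1, q.2⟫} :=
      isClosed_eq (by fun_prop) (by fun_prop)
    refine closure_minimal (s := (T.graph : Set (H × H))) ?_ hclosed hq
    rintro ⟨x, y⟩ hxy
    obtain ⟨a, rfl, rfl⟩ := T.mem_graph_iff.1 hxy
    exact hadj p (hle hp) a
  -- For `(u, v)` in the graph of the adjoint, solve `(T̄ - i) x = v - i u`; then `u - x` lies in a
  -- deficiency subspace, so that `u = x`.
  refine LinearPMap.eq_of_eq_graph (le_antisymm hle ?_)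
  rintro ⟨u, v⟩ huv
  obtain ⟨⟨x, y⟩, hxy, he⟩ := exists_mem_sub_I_smul_eq hcl.closure_isClosed hsymm
    (fun w hw => hminus w fun a => hw (a, T a)
      (LinearPMap.le_graph_of_le T.le_closure (T.mem_graph a))) (v - Complex.I • u)
  have hdiff := T.adjoint.graph.sub_mem huv (hle hxy)
  have hy : v - y = Complex.I • (u - x) := by
    dsimp only at he
    rw [smul_sub, sub_eq_sub_iff_add_eq_add]
    rw [sub_eq_sub_iff_add_eq_add] at he
    rw [← he]; abel
  have h0 : u - x = 0 := by
    refine hplus _ fun a => ?_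
    have := hadj _ hdiff a
    change ⟪v - y, (a : H)⟫ = ⟪u - x, T a⟫ at this
    rw [inner_add_right, ← this, hy, inner_smul_left, inner_smul_right, Complex.conj_I]
    ring
  rw [h0, smul_zero] at hy
  rwa [sub_eq_zero.1 h0, sub_eq_zero.1 hy]

theorem isSelfAdjoint_closure {T : H →ₗ.[ℂ] H} (hd : Dense (T.domain : Set H))
    (hs : T.IsFormalAdjoint T) (h : T.closure = T.adjoint) : IsSelfAdjoint T.closure := by
  have hd' : Dense (T.closure.domain : Set H) := hd.mono T.le_closure.1
  have hfa : T.closure.IsFormalAdjoint T := h ▸ LinearPMap.adjoint_isFormalAdjoint hd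
  rw [LinearPMap.isSelfAdjoint_def]
  refine le_antisymm ?_ ?_
  · rw [h]
    refine LinearPMap.IsFormalAdjoint.le_adjoint hd ?_
    intro x y
    obtain ⟨z, hz, hz'⟩ := LinearPMap.exists_of_le (h ▸ T.le_closure : T ≤ T.adjoint) x
    have := LinearPMap.adjoint_isFormalAdjoint (h ▸ hd' : Dense (T.adjoint.domain : Set H)) y z
    rw [← inner_conj_symm, ← inner_conj_symm (x : H), hz, this, hz']
  · refine LinearPMap.IsFormalAdjoint.le_adjoint hd' fun x y => ?_
    have hcl := isClosable_of_isFormalAdjoint hd hs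
    have hy : ((y : H), T.closure y) ∈ T.graph.topologicalClosure := by
      rw [hcl.graph_closure_eq_closure_graph]; exact T.closure.mem_graph y
    have hclosed : IsClosed {q : H × H | ⟪T.closure x, q.1⟫ = ⟪(x : H), q.2⟫} :=
      isClosed_eq (by fun_prop) (by fun_prop)
    refine closure_minimal (s := (T.graph : Set (H × H))) ?_ hclosed hy
    rintro ⟨a, b⟩ hab
    obtain ⟨c, rfl, rfl⟩ := T.mem_graph_iff.1 hab
    exact hfa x c

end Abstract

/-! ### Test functions away from the origin -/

section TestFunctions

variable {n : ℕ} {V W : Type*} [NormedAddCommGroup V] [NormedSpace ℝ V]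
  [NormedAddCommGroup W] [NormedSpace ℝ W]

/-- Smooth functions on `ℝⁿ` with compact support in `ℝⁿ \ {0}`. The support condition is
expressed by a closed annulus, and smoothness is only required away from the origin, near which
the function vanishes anyway. -/
def IsTest (g : E n → V) : Prop :=
  ContDiffOn ℝ ∞ g {0}ᶜ ∧ ∃ a b : ℝ, 0 < a ∧ ∀ ξ, g ξ ≠ 0 → a ≤ ‖ξ‖ ∧ ‖ξ‖ ≤ b

namespace IsTest

variable {g g₁ g₂ : E n → V}

/-- A function which is smooth off the origin and vanishes wherever a test function does is a test
function. -/
theorem of_eq_zero (hg : IsTest g) {F : E n → W} (hF : ContDiffOn ℝ ∞ F {0}ᶜ)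
    (h : ∀ ξ, g ξ = 0 → F ξ = 0) : IsTest F := by
  obtain ⟨-, a, b, ha, hab⟩ := hg
  exact ⟨hF, a, b, ha, fun ξ hξ => hab ξ fun h0 => hξ (h ξ h0)⟩

theorem eq_zero_at_zero (hg : IsTest g) : g 0 = 0 := by
  obtain ⟨-, a, b, ha, hab⟩ := hg
  by_contra h
  have := (hab 0 h).1
  rw [norm_zero] at this
  exact absurd ha (not_lt.2 this)

theorem contDiff (hg : IsTest g) : ContDiff ℝ ∞ g := by
  obtain ⟨hs, a, b, ha, hab⟩ := hg
  rw [contDiff_iff_contDiffAt]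
  intro ξ
  by_cases hξ : ξ = 0
  · subst hξ
    have : g =ᶠ[nhds 0] fun _ => 0 := by
      filter_upwards [Metric.ball_mem_nhds (0 : E n) ha] with x hx
      by_contra h
      rw [mem_ball_zero_iff] at hx
      exact absurd hx (not_lt.2 (hab x h).1)
    exact contDiffAt_const.congr_of_eventuallyEq this
  · exact hs.contDiffAt (isOpen_compl_singleton.mem_nhds hξ)

theorem tsupport_subset_annulus {U : Type*} [Zero U] {g : E n → U} {a b : ℝ}
    (hab : ∀ ξ, g ξ ≠ 0 → a ≤ ‖ξ‖ ∧ ‖ξ‖ ≤ b) :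
    tsupport g ⊆ {ξ | a ≤ ‖ξ‖ ∧ ‖ξ‖ ≤ b} :=
  closure_minimal (fun ξ hξ => hab ξ hξ)
    ((isClosed_le continuous_const continuous_norm).inter
      (isClosed_le continuous_norm continuous_const))

theorem hasCompactSupport (hg : IsTest g) : HasCompactSupport g := by
  obtain ⟨a, b, ha, hab⟩ := hg.2
  refine HasCompactSupport.of_support_subset_isCompact (isCompact_closedBall (0 : E n) b) ?_
  intro ξ hξ
  simpa using (hab ξ hξ).2

theorem zero_notMem_tsupport (hg : IsTest g) : (0 : E n) ∉ tsupport g := by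
  obtain ⟨a, b, ha, hab⟩ := hg.2
  intro h
  have := (tsupport_subset_annulus hab h).1
  rw [norm_zero] at this
  exact absurd ha (not_lt.2 this)

theorem of_contDiff (h : ContDiff ℝ ∞ g) (hc : HasCompactSupport g) (h0 : (0 : E n) ∉ tsupport g) :
    IsTest g := by
  refine ⟨h.contDiffOn, ?_⟩
  obtain ⟨a, ha, hsub⟩ := Metric.isOpen_iff.1 (isClosed_tsupport g).isOpen_compl 0 h0
  obtain ⟨b, hb⟩ := hc.isBounded.exists_norm_le
  refine ⟨a, b, ha, fun ξ hξ => ⟨?_, hb ξ (subset_tsupport g hξ)⟩⟩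
  by_contra hlt
  exact hsub (by simpa using hlt) (subset_tsupport g hξ)

theorem add (h₁ : IsTest g₁) (h₂ : IsTest g₂) : IsTest fun ξ => g₁ ξ + g₂ ξ := by
  obtain ⟨hs₁, a₁, b₁, ha₁, hab₁⟩ := h₁
  obtain ⟨hs₂, a₂, b₂, ha₂, hab₂⟩ := h₂
  refine ⟨hs₁.add hs₂, min a₁ a₂, max b₁ b₂, lt_min ha₁ ha₂, fun ξ hξ => ?_⟩
  by_cases h : g₁ ξ = 0
  · have := hab₂ ξ fun h' => hξ (by simp only [h, h', add_zero])
    exact ⟨min_le_of_right_le this.1, le_max_of_le_right this.2⟩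
  · have := hab₁ ξ h
    exact ⟨min_le_of_left_le this.1, le_max_of_le_left this.2⟩

theorem zero : IsTest (fun _ : E n => (0 : V)) :=
  ⟨contDiffOn_const, 1, 1, one_pos, fun _ h => absurd rfl h⟩

theorem sum {ι : Type*} (s : Finset ι) {g : ι → E n → V} (h : ∀ j ∈ s, IsTest (g j)) :
    IsTest fun ξ => ∑ j ∈ s, g j ξ := by
  classical
  induction s using Finset.induction_on with
  | empty => simpa using zero
  | insert a s ha ih =>
    simp only [Finset.sum_insert ha]
    exact (h a (Finset.mem_insert_self _ _)).add (ih fun j hj => h j (Finset.mem_insert_of_mem hj))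

theorem exists_schwartz (hg : IsTest g) : ∃ G : 𝓢(E n, V), ⇑G = g :=
  ⟨hg.hasCompactSupport.toSchwartzMap hg.contDiff, rfl⟩

theorem fderiv_apply (hg : IsTest g) (v : E n) : IsTest fun ξ => fderiv ℝ g ξ v := by
  obtain ⟨a, b, ha, hab⟩ := hg.2
  refine ⟨((hg.contDiff.fderiv_right (m := ∞) (by simp)).clm_apply contDiff_const).contDiffOn,
    a, b, ha, fun ξ hξ => tsupport_subset_annulus hab ?_⟩
  by_contra h
  exact hξ (by simp [fderiv_of_notMem_tsupport ℝ h])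

theorem fderiv_self (hg : IsTest g) : IsTest fun ξ => fderiv ℝ g ξ ξ := by
  obtain ⟨a, b, ha, hab⟩ := hg.2
  refine ⟨((hg.contDiff.fderiv_right (m := ∞) (by simp)).clm_apply contDiff_id).contDiffOn,
    a, b, ha, fun ξ hξ => tsupport_subset_annulus hab ?_⟩
  by_contra h
  exact hξ (by simp [fderiv_of_notMem_tsupport ℝ h])

theorem differentiableAt (hg : IsTest g) (ξ : E n) : DifferentiableAt ℝ g ξ :=
  hg.contDiff.differentiable (by simp) ξ

theorem continuous (hg : IsTest g) : Continuous g := hg.contDiff.continuous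

theorem integrable (hg : IsTest g) : Integrable g :=
  hg.continuous.integrable_of_hasCompactSupport hg.hasCompactSupport

theorem memLp (hg : IsTest g) (p : ENNReal) : MemLp g p :=
  hg.continuous.memLp_of_hasCompactSupport hg.hasCompactSupport

/-- The integral of a directional derivative vanishes. -/
theorem integral_fderiv_apply (hg : IsTest g) (v : E n) : ∫ ξ, fderiv ℝ g ξ v = 0 := by
  -- Integrate by parts against a compactly supported function equal to `1` near the support.
  by_cases hV : CompleteSpace V
  swap
  · simp [integral, hV]
  have h := integral_bilinear_hasLineDerivAt_right_eq_neg_left_of_integrable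
    (μ := (volume : Measure (E n))) (f := fun _ => (1 : ℝ)) (f' := fun _ => (0 : ℝ)) (g := g)
    (g' := fun ξ => fderiv ℝ g ξ v) (v := v) (B := ContinuousLinearMap.lsmul ℝ ℝ)
    (by simp) (by simpa using (hg.fderiv_apply v).integrable) (by simpa using hg.integrable)
    (fun x _ => by simpa using (hasFDerivAt_const (𝕜 := ℝ) (1 : ℝ) x).hasLineDerivAt v)
    (fun x _ => (hg.differentiableAt x).hasFDerivAt.hasLineDerivAt v)
  simpa using h

end IsTest

/-- Expansion of the derivative in the coordinate directions. -/
theorem fderiv_self_eq_sum (g : E n → V) (ξ : E n) :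
    fderiv ℝ g ξ ξ = ∑ j, ξ j • fderiv ℝ g ξ (EuclideanSpace.single j 1) := by
  have h : ξ = ∑ j, ξ j • EuclideanSpace.single j (1 : ℝ) := by
    simpa using ((EuclideanSpace.basisFun (Fin n) ℝ).sum_repr ξ).symm
  conv_lhs => enter [2]; rw [h]
  simp only [map_sum, map_smul]

/-- The divergence of `ξ ↦ g ξ ⊗ ξ` is `ξ · ∇ g + n g`. -/
theorem sum_fderiv_coord_smul {g : E n → V} {ξ : E n} (hg : DifferentiableAt ℝ g ξ) :
    ∑ j, fderiv ℝ (fun ζ : E n => ζ j • g ζ) ξ (EuclideanSpace.single j 1)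
      = fderiv ℝ g ξ ξ + (n : ℝ) • g ξ := by
  have h (j : Fin n) : fderiv ℝ (fun ζ : E n => ζ j • g ζ) ξ (EuclideanSpace.single j 1)
      = ξ j • fderiv ℝ g ξ (EuclideanSpace.single j 1) + g ξ := by
    have hj : HasFDerivAt (fun ζ : E n => ζ j) (EuclideanSpace.proj j : E n →L[ℝ] ℝ) ξ :=
      (EuclideanSpace.proj j : E n →L[ℝ] ℝ).hasFDerivAt
    rw [HasFDerivAt.fderiv (hj.fun_smul hg.hasFDerivAt)]
    simp
  simp only [h, Finset.sum_add_distrib, ← fderiv_self_eq_sum]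
  simp [Nat.cast_smul_eq_nsmul]

theorem IsTest.integral_fderiv_self_add {g : E n → V} (hg : IsTest g) :
    ∫ ξ, (fderiv ℝ g ξ ξ + (n : ℝ) • g ξ) = 0 := by
  have hj (j : Fin n) : IsTest fun ζ : E n => ζ j • g ζ :=
    hg.of_eq_zero (((EuclideanSpace.proj j : E n →L[ℝ] ℝ).contDiff.smul hg.contDiff).contDiffOn)
      fun ξ h => by simp [h]
  simp only [← sum_fderiv_coord_smul (hg.differentiableAt _)]
  rw [integral_finsetSum _ fun j _ => ((hj j).fderiv_apply _).integrable]
  exact Finset.sum_eq_zero fun j _ => (hj j).integral_fderiv_apply _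

end TestFunctions

/-! ### Functions with prescribed Fourier transform -/

section FourierRepresentation

variable {n N : ℕ}

/-- The Fourier transform of `f` is the test function `g`. By `mem_D0_iff`, the elements of `𝒟₀` are
the `f` for which such a `g` exists. -/
def HasSymbol (f : L2 n N) (g : E n → EuclideanSpace ℂ (Fin N)) : Prop :=
  IsTest g ∧ fourierL2 f =ᵐ[volume] g

theorem mem_D0_iff {f : L2 n N} : f ∈ D0 n N ↔ ∃ g, HasSymbol f g := by
  constructor
  · rintro ⟨g, h1, h2, h3, h4⟩
    exact ⟨g, IsTest.of_contDiff h1 h2 h3, h4⟩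
  · rintro ⟨g, hg, h⟩
    exact ⟨g, hg.contDiff, hg.hasCompactSupport, hg.zero_notMem_tsupport, h⟩

theorem IsTest.exists_hasSymbol {g : E n → EuclideanSpace ℂ (Fin N)} (hg : IsTest g) :
    ∃ f : L2 n N, HasSymbol f g :=
  ⟨fourierL2.symm ((hg.memLp 2).toLp g), hg, by
    rw [LinearIsometryEquiv.apply_symm_apply]; exact (hg.memLp 2).coeFn_toLp⟩

namespace HasSymbol

variable {f f₁ f₂ : L2 n N} {g g₁ g₂ : E n → EuclideanSpace ℂ (Fin N)}

theorem congr (h : HasSymbol f g₁) (hg : IsTest g₂) (he : ∀ ξ, ξ ≠ 0 → g₁ ξ = g₂ ξ) :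
    HasSymbol f g₂ := by
  have : g₁ = g₂ := by
    ext1 ξ
    by_cases hξ : ξ = 0
    · rw [hξ, h.1.eq_zero_at_zero, hg.eq_zero_at_zero]
    · exact he ξ hξ
  exact this ▸ h

theorem unique (h₁ : HasSymbol f₁ g) (h₂ : HasSymbol f₂ g) : f₁ = f₂ :=
  fourierL2.injective (Lp.ext (h₁.2.trans h₂.2.symm))

theorem add (h₁ : HasSymbol f₁ g₁) (h₂ : HasSymbol f₂ g₂) :
    HasSymbol (f₁ + f₂) fun ξ => g₁ ξ + g₂ ξ :=
  ⟨h₁.1.add h₂.1, by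
    rw [map_add]; exact (Lp.coeFn_add _ _).trans (h₁.2.add h₂.2)⟩

theorem smul (c : ℂ) (h : HasSymbol f g) : HasSymbol (c • f) fun ξ => c • g ξ :=
  ⟨h.1.of_eq_zero (h.1.contDiff.const_smul c).contDiffOn fun ξ h => by rw [h, smul_zero], by
    rw [map_smul]; exact (Lp.coeFn_smul _ _).trans (h.2.const_smul c)⟩

theorem zero : HasSymbol (0 : L2 n N) fun _ => 0 :=
  ⟨IsTest.zero, by rw [map_zero]; exact Lp.coeFn_zero _ _ _⟩

theorem sum {ι : Type*} (s : Finset ι) {f : ι → L2 n N}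
    {g : ι → E n → EuclideanSpace ℂ (Fin N)} (h : ∀ j ∈ s, HasSymbol (f j) (g j)) :
    HasSymbol (∑ j ∈ s, f j) fun ξ => ∑ j ∈ s, g j ξ := by
  classical
  induction s using Finset.induction_on with
  | empty => simpa using zero
  | insert a s ha ih =>
    simp only [Finset.sum_insert ha]
    exact (h a (Finset.mem_insert_self _ _)).add (ih fun j hj => h j (Finset.mem_insert_of_mem hj))

/-- Plancherel, with one argument in `𝒟₀`. -/
theorem inner_right (u : L2 n N) (h : HasSymbol f g) :
    inner ℂ u f = ∫ ξ, inner ℂ (fourierL2 u ξ) (g ξ) := by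
  rw [← (fourierL2 (n := n) (N := N)).inner_map_map u f, L2.inner_def]
  refine integral_congr_ae ?_
  filter_upwards [h.2] with ξ hξ
  rw [hξ]

theorem inner_eq (h₁ : HasSymbol f₁ g₁) (h₂ : HasSymbol f₂ g₂) :
    inner ℂ f₁ f₂ = ∫ ξ, inner ℂ (g₁ ξ) (g₂ ξ) := by
  rw [h₂.inner_right]
  refine integral_congr_ae ?_
  filter_upwards [h₁.2] with ξ hξ
  rw [hξ]

theorem norm_le (h₁ : HasSymbol f₁ g₁) (h₂ : HasSymbol f₂ g₂) {C : ℝ}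
    (h : ∀ ξ, ‖g₂ ξ‖ ≤ C * ‖g₁ ξ‖) : ‖f₂‖ ≤ C * ‖f₁‖ := by
  rw [← (fourierL2 (n := n) (N := N)).norm_map f₁, ← (fourierL2 (n := n) (N := N)).norm_map f₂]
  refine Lp.norm_le_mul_norm_of_ae_le_mul ?_
  filter_upwards [h₁.2, h₂.2] with ξ h1 h2
  rw [h1, h2]
  exact h ξ

/-- A function in `𝒟₀` is the inverse Fourier transform of a Schwartz function. -/
theorem eq_toLp {G : 𝓢(E n, EuclideanSpace ℂ (Fin N))} (h : HasSymbol f G) :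
    f = (𝓕⁻ G).toLp 2 := by
  rw [← SchwartzMap.toLp_fourierInv_eq]
  apply (fourierL2 (n := n) (N := N)).injective
  change _ = fourierL2 (fourierL2.symm _)
  rw [LinearIsometryEquiv.apply_symm_apply]
  exact Lp.ext (h.2.trans (SchwartzMap.coeFn_toLp G 2 volume).symm)

theorem of_toLp {G : 𝓢(E n, EuclideanSpace ℂ (Fin N))} (hG : IsTest G) :
    HasSymbol ((𝓕⁻ G).toLp 2 : L2 n N) G := by
  obtain ⟨f, hf⟩ := hG.exists_hasSymbol
  rwa [← hf.eq_toLp]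

end HasSymbol

/-- `f` lies in the domain of `T`, and the Fourier transform of `T f` is the test function `g`. -/
def MapsToSymbol (T : L2 n N →ₗ.[ℂ] L2 n N) (f : L2 n N)
    (g : E n → EuclideanSpace ℂ (Fin N)) : Prop :=
  ∃ f', HasSymbol f' g ∧ (f, f') ∈ T.graph

namespace MapsToSymbol

variable {S T : L2 n N →ₗ.[ℂ] L2 n N} {f : L2 n N} {g g₁ g₂ : E n → EuclideanSpace ℂ (Fin N)}

theorem opMul (hT : MapsToSymbol T f g₁) (hS : ∀ f', HasSymbol f' g₁ → MapsToSymbol S f' g₂) :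
    MapsToSymbol (opMul S T) f g₂ := by
  obtain ⟨f', hf', hg⟩ := hT
  obtain ⟨f'', hf'', hg'⟩ := hS f' hf'
  exact ⟨f'', hf'', mem_graph_opMul hg hg'⟩

theorem add (hS : MapsToSymbol S f g₁) (hT : MapsToSymbol T f g₂) :
    MapsToSymbol (S + T) f fun ξ => g₁ ξ + g₂ ξ := by
  obtain ⟨f', hf', hg⟩ := hS
  obtain ⟨f'', hf'', hg'⟩ := hT
  exact ⟨f' + f'', hf'.add hf'', mem_graph_add hg hg'⟩

theorem smul (c : ℂ) (hT : MapsToSymbol T f g) : MapsToSymbol (c • T) f fun ξ => c • g ξ := by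
  obtain ⟨f', hf', hg⟩ := hT
  exact ⟨c • f', hf'.smul c, mem_graph_smul c hg⟩

theorem sum {T : Fin n → L2 n N →ₗ.[ℂ] L2 n N} {g : Fin n → E n → EuclideanSpace ℂ (Fin N)}
    (h : ∀ j, MapsToSymbol (T j) f (g j)) :
    MapsToSymbol (∑ j, T j) f fun ξ => ∑ j, g j ξ := by
  choose f' hf' hg using h
  exact ⟨∑ j, f' j, HasSymbol.sum _ fun j _ => hf' j, mem_graph_sum _ fun j _ => hg j⟩

end MapsToSymbol

variable {f : L2 n N} {g : E n → EuclideanSpace ℂ (Fin N)}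

/-- Here `𝓕` has kernel `exp (-2πi x · ξ)`, so that `x_j` corresponds to `(i / 2π) ∂_j`. -/
theorem fourierInv_mem_graph_position (G : 𝓢(E n, EuclideanSpace ℂ (Fin N))) (j : Fin n) :
    (((𝓕⁻ G).toLp 2 : L2 n N), (Complex.I / (2 * Real.pi)) •
      ((𝓕⁻ (∂_{EuclideanSpace.single j (1 : ℝ)} G)).toLp 2 : L2 n N)) ∈ (position j).graph := by
  rw [position, mem_graph_mulOp, SchwartzMap.fourierInv_lineDerivOp_eq]
  generalize 𝓕⁻ G = F
  have hv : (fun x : E n => inner ℝ x (EuclideanSpace.single j (1 : ℝ))).HasTemperateGrowth := by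
    fun_prop
  filter_upwards [Lp.coeFn_smul (Complex.I / (2 * Real.pi))
      ((-(2 * Real.pi * Complex.I) • smulLeftCLM (EuclideanSpace ℂ (Fin N))
        (inner ℝ · (EuclideanSpace.single j (1 : ℝ))) F).toLp 2 : L2 n N),
    SchwartzMap.coeFn_toLp (-(2 * Real.pi * Complex.I) • smulLeftCLM (EuclideanSpace ℂ (Fin N))
      (inner ℝ · (EuclideanSpace.single j (1 : ℝ))) F) 2 (volume : Measure (E n)),
    SchwartzMap.coeFn_toLp F 2 (volume : Measure (E n))] with x h1 h2 h3
  rw [h1, Pi.smul_apply, h2, h3, smul_apply,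
    SchwartzMap.smulLeftCLM_apply_apply hv, smul_smul]
  have hx : inner ℝ x (EuclideanSpace.single j (1 : ℝ)) = x j := by
    simp [EuclideanSpace.inner_single_right]
  have hI : Complex.I / (2 * Real.pi) * -(2 * Real.pi * Complex.I) = 1 := by
    have : (Real.pi : ℂ) ≠ 0 := by simp [Real.pi_ne_zero]
    field_simp
    simp
  rw [hx, hI, one_smul, Complex.coe_smul]

theorem fourierInv_mem_graph_momentum (G : 𝓢(E n, EuclideanSpace ℂ (Fin N))) (j : Fin n) :
    (((𝓕⁻ G).toLp 2 : L2 n N), ((𝓕⁻ ((2 * Real.pi : ℂ) •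
      smulLeftCLM (EuclideanSpace ℂ (Fin N)) (inner ℝ · (EuclideanSpace.single j (1 : ℝ))) G)).toLp
        2 : L2 n N)) ∈ (momentum j).graph := by
  rw [mem_graph_momentum, Lp.toTemperedDistribution_toLp_eq,
    Lp.toTemperedDistribution_toLp_eq,
    TemperedDistribution.lineDerivOp_toTemperedDistributionCLM_eq,
    SchwartzMap.lineDerivOp_fourierInv_eq]
  generalize smulLeftCLM (EuclideanSpace ℂ (Fin N))
    (inner ℝ · (EuclideanSpace.single j (1 : ℝ))) G = K
  rw [FourierTransform.fourierInv_smul, FourierTransform.fourierInv_smul, map_smul, map_smul,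
    smul_smul]
  congr 1
  linear_combination (2 * Real.pi : ℂ) * Complex.I_mul_I

theorem HasSymbol.position (h : HasSymbol f g) (j : Fin n) :
    MapsToSymbol (position j) f
      fun ξ => (Complex.I / (2 * Real.pi)) • fderiv ℝ g ξ (EuclideanSpace.single j 1) := by
  obtain ⟨G, rfl⟩ := h.1.exists_schwartz
  have hd : IsTest ⇑(∂_{EuclideanSpace.single j (1 : ℝ)} G : 𝓢(E n, EuclideanSpace ℂ (Fin N))) :=
    h.1.fderiv_apply _
  refine ⟨_, (HasSymbol.of_toLp hd).smul _, ?_⟩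
  rw [h.eq_toLp]
  exact fourierInv_mem_graph_position G j

theorem HasSymbol.momentum (h : HasSymbol f g) (j : Fin n) :
    MapsToSymbol (momentum j) f fun ξ => ((2 * Real.pi * ξ j : ℝ) : ℂ) • g ξ := by
  obtain ⟨G, rfl⟩ := h.1.exists_schwartz
  have hv : (fun x : E n => inner ℝ x (EuclideanSpace.single j (1 : ℝ))).HasTemperateGrowth := by
    fun_prop
  have he : (fun ξ : E n => ((2 * Real.pi * ξ j : ℝ) : ℂ) • G ξ) = ⇑((2 * Real.pi : ℂ) •
      smulLeftCLM (EuclideanSpace ℂ (Fin N)) (inner ℝ · (EuclideanSpace.single j (1 : ℝ))) G) := by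
    ext1 ξ
    have hx : inner ℝ ξ (EuclideanSpace.single j (1 : ℝ)) = ξ j := by
      simp [EuclideanSpace.inner_single_right]
    rw [smul_apply, SchwartzMap.smulLeftCLM_apply_apply hv, hx,
      ← Complex.coe_smul (ξ j), smul_smul]
    push_cast
    rfl
  rw [he]
  refine ⟨_, HasSymbol.of_toLp ?_, ?_⟩
  · refine h.1.of_eq_zero (SchwartzMap.smooth _ ⊤).contDiffOn fun ξ h0 => ?_
    rw [smul_apply, SchwartzMap.smulLeftCLM_apply_apply hv, h0, smul_zero, smul_zero]
  · rw [h.eq_toLp]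
    exact fourierInv_mem_graph_momentum G j

theorem HasSymbol.momentumFn (h : HasSymbol f g) {m : E n → ℂ}
    (hm : ContDiffOn ℝ ∞ (fun ξ => m ((2 * Real.pi) • ξ)) {0}ᶜ) :
    MapsToSymbol (momentumFn m) f fun ξ => m ((2 * Real.pi) • ξ) • g ξ := by
  have hd : IsTest fun ξ : E n => m ((2 * Real.pi) • ξ) • g ξ :=
    h.1.of_eq_zero (hm.smul h.1.1) fun ξ h0 => by rw [h0, smul_zero]
  obtain ⟨f', hf'⟩ := hd.exists_hasSymbol
  refine ⟨f', hf', ?_⟩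
  have h1 : (f, fourierL2 f) ∈
      ((fourierL2 (n := n) (N := N)).toLinearEquiv.toLinearMap.toPMap ⊤).graph :=
    (LinearPMap.mem_graph_iff _).2 ⟨⟨f, trivial⟩, rfl, rfl⟩
  have h2 : (fourierL2 f, fourierL2 f') ∈
      (mulOp (n := n) (N := N) fun ξ => m ((2 * Real.pi) • ξ)).graph := by
    rw [mem_graph_mulOp]
    filter_upwards [h.2, hf'.2] with ξ h1 h2
    rw [h1, h2]
  have h3 := mem_graph_compPMap (fourierL2 (n := n) (N := N)).symm.toLinearEquiv.toLinearMap
    (mem_graph_opMul h1 h2)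
  have h4 : (fourierL2 (n := n) (N := N)).symm.toLinearEquiv.toLinearMap (fourierL2 f') = f' :=
    LinearIsometryEquiv.symm_apply_apply _ _
  rw [h4] at h3
  exact h3

/-- Constant matrices commute with the Fourier transform. -/
theorem compLp_fourierInv (L : EuclideanSpace ℂ (Fin N) →L[ℂ] EuclideanSpace ℂ (Fin N))
    {G G' : 𝓢(E n, EuclideanSpace ℂ (Fin N))} (h : ∀ ξ, G' ξ = L (G ξ)) :
    L.compLp ((𝓕⁻ G).toLp 2 : L2 n N) = (𝓕⁻ G').toLp 2 := by
  refine Lp.ext ?_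
  filter_upwards [L.coeFn_compLp ((𝓕⁻ G).toLp 2 : L2 n N),
    SchwartzMap.coeFn_toLp (𝓕⁻ G) 2 (volume : Measure (E n)),
    SchwartzMap.coeFn_toLp (𝓕⁻ G') 2 (volume : Measure (E n))] with x h1 h2 h3
  rw [h1, h2, h3, SchwartzMap.fourierInv_coe, SchwartzMap.fourierInv_coe, Real.fourierInv_eq,
    Real.fourierInv_eq, ← ContinuousLinearMap.integral_comp_comm]
  · refine integral_congr_ae (Filter.Eventually.of_forall fun ξ => ?_)
    simp only [Circle.smul_def, map_smul, h]
  · rw [← integrable_norm_iff]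
    · simpa using G.integrable.norm
    · exact Continuous.aestronglyMeasurable (by fun_prop)

theorem HasSymbol.matrixOp (h : HasSymbol f g) (M : Matrix (Fin N) (Fin N) ℂ) :
    HasSymbol (matrixOp M f) fun ξ => Matrix.toEuclideanCLM (n := Fin N) (𝕜 := ℂ) M (g ξ) := by
  obtain ⟨G, rfl⟩ := h.1.exists_schwartz
  have hd : IsTest fun ξ => Matrix.toEuclideanCLM (n := Fin N) (𝕜 := ℂ) M (G ξ) :=
    h.1.of_eq_zero (((Matrix.toEuclideanCLM (n := Fin N) (𝕜 := ℂ) M).restrictScalars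
      ℝ).contDiff.comp h.1.contDiff).contDiffOn fun ξ h0 => by rw [h0, map_zero]
  obtain ⟨G', hG'⟩ := hd.exists_schwartz
  rw [← hG'] at hd ⊢
  have := HasSymbol.of_toLp hd
  rwa [← compLp_fourierInv _ fun ξ => congrFun hG' ξ, ← h.eq_toLp] at this

end FourierRepresentation

/-! ### Transport along a radial flow -/

section Transport

/-- A vector field `C ∂_y` on the line with `0 < C ≤ K` is complete: its time function `T`, with
`T' = 1 / C`, is a diffeomorphism of the line, and the flow is `y ↦ T⁻¹ (T y + t)`. -/
theorem exists_time_function {C : ℝ → ℝ} (hC : ContDiff ℝ ∞ C) (hpos : ∀ y, 0 < C y) {K : ℝ}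
    (hK : ∀ y, C y ≤ K) :
    ∃ T Θ : ℝ → ℝ, ContDiff ℝ ∞ T ∧ ContDiff ℝ ∞ Θ ∧ (∀ y, HasDerivAt T (C y)⁻¹ y) ∧
      Monotone T ∧ Monotone Θ ∧ (∀ y, Θ (T y) = y) ∧ ∀ s, T (Θ s) = s := by
  have hKpos : 0 < K := (hpos 0).trans_le (hK 0)
  have hCi : ContDiff ℝ ∞ fun y => (C y)⁻¹ := hC.inv fun y => (hpos y).ne'
  set T : ℝ → ℝ := fun y => ∫ r in (0 : ℝ)..y, (C r)⁻¹ with hT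
  have hderiv (y : ℝ) : HasDerivAt T (C y)⁻¹ y :=
    hCi.continuous.integral_hasStrictDerivAt 0 y |>.hasDerivAt
  have hsmooth : ContDiff ℝ ∞ T := by
    rw [contDiff_infty_iff_deriv]
    exact ⟨fun y => (hderiv y).differentiableAt, by
      rwa [show deriv T = fun y => (C y)⁻¹ from funext fun y => (hderiv y).deriv]⟩
  have hmono : StrictMono T := strictMono_of_deriv_pos fun y => by
    rw [(hderiv y).deriv]; exact inv_pos.2 (hpos y)
  -- `T` is onto, because `T' ≥ K⁻¹`.
  have hlin : Monotone fun y => T y - K⁻¹ * y := by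
    have hd (y : ℝ) : HasDerivAt (fun y => T y - K⁻¹ * y) ((C y)⁻¹ - K⁻¹ * 1) y :=
      (hderiv y).sub ((hasDerivAt_id y).const_mul _)
    refine monotone_of_deriv_nonneg (fun y => (hd y).differentiableAt) fun y => ?_
    rw [(hd y).deriv, mul_one, sub_nonneg]
    exact inv_anti₀ (hpos y) (hK y)
  have hT0 : T 0 = 0 := by simp [hT]
  have htop : Filter.Tendsto T Filter.atTop Filter.atTop := by
    refine Filter.tendsto_atTop_mono' _ ?_
      (Filter.tendsto_id.const_mul_atTop (inv_pos.2 hKpos))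
    filter_upwards [Filter.eventually_ge_atTop 0] with y hy
    have := hlin hy
    simp only [hT0, id] at this ⊢
    linarith
  have hbot : Filter.Tendsto T Filter.atBot Filter.atBot := by
    refine Filter.tendsto_atBot_mono' _ ?_
      (Filter.tendsto_id.const_mul_atBot (inv_pos.2 hKpos))
    filter_upwards [Filter.eventually_le_atBot 0] with y hy
    have := hlin hy
    simp only [hT0, id] at this ⊢
    linarith
  let e : ℝ ≃o ℝ := hmono.orderIsoOfSurjective T (hsmooth.continuous.surjective htop hbot)
  refine ⟨T, e.symm, hsmooth, ?_, hderiv, hmono.monotone, e.symm.monotone,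
    fun y => e.symm_apply_apply y, fun s => e.apply_symm_apply s⟩
  exact e.toHomeomorph.contDiff_symm_deriv (fun y => (inv_pos.2 (hpos y)).ne') hderiv hsmooth

variable {n : ℕ} {V : Type*} [NormedAddCommGroup V] [NormedSpace ℝ V]

/-- The transport along the radial flow which in the logarithmic radius `y = log ‖ξ‖` reads
`y ↦ Θ (T y + t)`, weighted by the exponential of the increment of `L`. Here `T` is a time function
of the flow and `Θ` its inverse. At the origin, where `Real.log 0 = 0`, the value is a multiple of
`g 0`. -/
def transport (T Θ L : ℝ → ℝ) (g : E n → V) (t : ℝ) (ξ : E n) : V :=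
  Real.exp (L (Θ (T (Real.log ‖ξ‖) + t)) - L (Real.log ‖ξ‖)) •
    g (Real.exp (Θ (T (Real.log ‖ξ‖) + t) - Real.log ‖ξ‖) • ξ)

/-- The first order operator `c ξ · ∇ + (ξ · ∇ c + n c) / 2` with `c ξ = C (log ‖ξ‖)`, the
generator of the unitary group of the flow of the vector field `c ξ`. -/
def radialGenerator (C : ℝ → ℝ) (g : E n → V) (ξ : E n) : V :=
  C (Real.log ‖ξ‖) • fderiv ℝ g ξ ξ +
    ((deriv C (Real.log ‖ξ‖) + n * C (Real.log ‖ξ‖)) / 2) • g ξ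

theorem contDiffOn_log_norm : ContDiffOn ℝ ∞ (fun ξ : E n => Real.log ‖ξ‖) {0}ᶜ := fun _ hξ =>
  ((contDiffAt_norm ℝ hξ).log (norm_ne_zero_iff.2 hξ)).contDiffWithinAt

theorem IsTest.radialGenerator {g : E n → V} (hg : IsTest g) {C : ℝ → ℝ} (hC : ContDiff ℝ ∞ C) :
    IsTest (radialGenerator C g) := by
  have hC' : ContDiff ℝ ∞ (deriv C) := (contDiff_infty_iff_deriv.1 hC).2
  have h1 : ContDiffOn ℝ ∞ (fun ξ : E n => C (Real.log ‖ξ‖)) {0}ᶜ :=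
    hC.comp_contDiffOn contDiffOn_log_norm
  have h2 : ContDiffOn ℝ ∞ (fun ξ : E n => deriv C (Real.log ‖ξ‖)) {0}ᶜ :=
    hC'.comp_contDiffOn contDiffOn_log_norm
  exact (hg.fderiv_self.of_eq_zero (h1.smul hg.fderiv_self.1) fun ξ h => by simp [h]).add
    (hg.of_eq_zero (((h2.add (contDiffOn_const.mul h1)).div_const 2).smul hg.1)
      fun ξ h => by simp only [h, smul_zero])

variable {C T Θ L : ℝ → ℝ} {g : E n → V}

theorem transport_zero_time (hΘT : ∀ y, Θ (T y) = y) : transport T Θ L g 0 = g := by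
  ext1 ξ
  simp [transport, hΘT]

theorem contDiffOn_transport (hT : ContDiff ℝ ∞ T) (hΘ : ContDiff ℝ ∞ Θ) (hL : ContDiff ℝ ∞ L)
    (hg : ContDiff ℝ ∞ g) :
    ContDiffOn ℝ ∞ (fun p : ℝ × E n => transport T Θ L g p.1 p.2) (Set.univ ×ˢ {0}ᶜ) := by
  have hlog : ContDiffOn ℝ ∞ (fun p : ℝ × E n => Real.log ‖p.2‖) (Set.univ ×ˢ {0}ᶜ) :=
    contDiffOn_log_norm.comp contDiff_snd.contDiffOn fun p hp => hp.2
  have hs : ContDiffOn ℝ ∞ (fun p : ℝ × E n => Θ (T (Real.log ‖p.2‖) + p.1))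
      (Set.univ ×ˢ {0}ᶜ) :=
    hΘ.comp_contDiffOn ((hT.comp_contDiffOn hlog).add contDiff_fst.contDiffOn)
  exact (((hL.comp_contDiffOn hs).sub (hL.comp_contDiffOn hlog)).exp).smul
    (hg.comp_contDiffOn ((hs.sub hlog).exp.smul contDiff_snd.contDiffOn))

/-- During a bounded time, the support of a test function stays in a fixed annulus. -/
theorem transport_support (hT : Monotone T) (hΘ : Monotone Θ) (hΘT : ∀ y, Θ (T y) = y)
    (hTΘ : ∀ s, T (Θ s) = s) (hg : IsTest g) (t₀ : ℝ) :
    ∃ a b : ℝ, 0 < a ∧ ∀ t ∈ Set.Icc (t₀ - 1) (t₀ + 1), ∀ ξ,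
      transport T Θ L g t ξ ≠ 0 → a ≤ ‖ξ‖ ∧ ‖ξ‖ ≤ b := by
  obtain ⟨a, b, ha, hab⟩ := hg.2
  refine ⟨Real.exp (Θ (T (Real.log a) - (t₀ + 1))), Real.exp (Θ (T (Real.log b) - (t₀ - 1))),
    Real.exp_pos _, fun t ht ξ hξ => ?_⟩
  have hξ0 : ξ ≠ 0 := by
    rintro rfl
    exact hξ (by simp [transport, hg.eq_zero_at_zero])
  have hn : 0 < ‖ξ‖ := norm_pos_iff.2 hξ0
  have hg0 : g (Real.exp (Θ (T (Real.log ‖ξ‖) + t) - Real.log ‖ξ‖) • ξ) ≠ 0 := fun h =>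
    hξ (by rw [transport, h, smul_zero])
  have hnorm : ‖Real.exp (Θ (T (Real.log ‖ξ‖) + t) - Real.log ‖ξ‖) • ξ‖
      = Real.exp (Θ (T (Real.log ‖ξ‖) + t)) := by
    rw [norm_smul, Real.norm_eq_abs, Real.abs_exp, Real.exp_sub, Real.exp_log hn]
    field_simp
  have h := hab _ hg0
  rw [hnorm] at h
  have hb : 0 < b := (Real.exp_pos _).trans_le h.2
  have h1 := hT ((Real.log_le_iff_le_exp ha).2 h.1)
  have h2 := hT ((Real.le_log_iff_exp_le hb).2 h.2)
  rw [hTΘ] at h1 h2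
  have h3 : Θ (T (Real.log a) - (t₀ + 1)) ≤ Real.log ‖ξ‖ := by
    rw [← hΘT (Real.log ‖ξ‖)]
    exact hΘ (by linarith [ht.2])
  have h4 : Real.log ‖ξ‖ ≤ Θ (T (Real.log b) - (t₀ - 1)) := by
    rw [← hΘT (Real.log ‖ξ‖)]
    exact hΘ (by linarith [ht.1])
  rw [← Real.exp_log hn]
  exact ⟨Real.exp_le_exp.2 h3, Real.exp_le_exp.2 h4⟩

theorem isTest_transport (hT : ContDiff ℝ ∞ T) (hΘ : ContDiff ℝ ∞ Θ) (hL : ContDiff ℝ ∞ L)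
    (hTm : Monotone T) (hΘm : Monotone Θ) (hΘT : ∀ y, Θ (T y) = y)
    (hTΘ : ∀ s, T (Θ s) = s) (hg : IsTest g) (t : ℝ) : IsTest (transport T Θ L g t) := by
  obtain ⟨a, b, ha, hab⟩ := transport_support (L := L) hTm hΘm hΘT hTΘ hg t
  have hmem : t ∈ Set.Icc (t - 1) (t + 1) := ⟨by linarith, by linarith⟩
  refine ⟨fun ξ hξ => ?_, a, b, ha, hab t hmem⟩
  have h1 : ContDiffAt ℝ ∞ (fun p : ℝ × E n => transport T Θ L g p.1 p.2) (t, ξ) :=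
    (contDiffOn_transport hT hΘ hL hg.contDiff).contDiffAt
      ((isOpen_univ.prod isOpen_compl_singleton).mem_nhds ⟨Set.mem_univ t, hξ⟩)
  have h2 : ContDiffAt ℝ ∞ (fun ξ : E n => (t, ξ)) ξ := contDiffAt_const.prodMk contDiffAt_id
  have h3 := ContDiffAt.comp ξ h1 h2
  exact h3.contDiffWithinAt

/-- The derivative along the Euler vector field, computed on a ray. -/
theorem fderiv_self_eq_of_hasDerivAt {g : E n → V} {ξ : E n} {v : V}
    (hg : DifferentiableAt ℝ g ξ) (h : HasDerivAt (fun z : ℝ => g (Real.exp z • ξ)) v 0) :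
    fderiv ℝ g ξ ξ = v := by
  have h1 : HasDerivAt (fun z : ℝ => Real.exp z • ξ) (Real.exp 0 • ξ) 0 :=
    (Real.hasDerivAt_exp 0).smul_const ξ
  rw [Real.exp_zero, one_smul] at h1
  have h2 : HasFDerivAt g (fderiv ℝ g ξ) (Real.exp 0 • ξ) := by
    rw [Real.exp_zero, one_smul]; exact hg.hasFDerivAt
  exact (h2.comp_hasDerivAt 0 h1).unique h

theorem log_norm_exp_smul {ξ : E n} (hξ : ξ ≠ 0) (z : ℝ) :
    Real.log ‖Real.exp z • ξ‖ = Real.log ‖ξ‖ + z := by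
  rw [norm_smul, Real.norm_eq_abs, Real.abs_exp,
    Real.log_mul (Real.exp_pos z).ne' (norm_ne_zero_iff.2 hξ), Real.log_exp, add_comm]

/-- The transport solves `∂_t U_t g = R (U_t g)` for the radial generator `R`. The weight `L` is
such that `exp L` is a multiple of the square root of `C y * exp (n * y)`. -/
theorem hasDerivAt_transport (hpos : ∀ y, 0 < C y) (hT : ContDiff ℝ ∞ T)
    (hT' : ∀ y, HasDerivAt T (C y)⁻¹ y) (hΘ : ContDiff ℝ ∞ Θ) (hL : ContDiff ℝ ∞ L)
    (hL' : ∀ y, HasDerivAt L ((deriv C y / C y + n) / 2) y)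
    (hTm : Monotone T) (hΘm : Monotone Θ) (hΘT : ∀ y, Θ (T y) = y)
    (hTΘ : ∀ s, T (Θ s) = s) (hg : IsTest g) (t : ℝ) (ξ : E n) :
    HasDerivAt (fun t => transport T Θ L g t ξ)
      (radialGenerator C (transport T Θ L g t) ξ) t := by
  by_cases hξ : ξ = 0
  · subst hξ
    have h0 (t : ℝ) : transport T Θ L g t 0 = 0 := by simp [transport, hg.eq_zero_at_zero]
    simpa [radialGenerator, h0] using hasDerivAt_const t (0 : V)
  set y := Real.log ‖ξ‖ with hy
  -- Along the ray of `ξ`, the transported function is `exp (-L y) G (T y + t)`.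
  set G : ℝ → V := fun s => Real.exp (L (Θ s)) • g (Real.exp (Θ s - y) • ξ) with hG
  have hGd : Differentiable ℝ G := by
    refine ContDiff.differentiable (n := ∞) ?_ (by simp)
    exact (hL.comp hΘ).exp.smul
      (hg.contDiff.comp ((hΘ.sub contDiff_const).exp.smul contDiff_const))
  have hU (t : ℝ) : transport T Θ L g t ξ = Real.exp (-L y) • G (T y + t) := by
    rw [transport, hG, smul_smul, ← Real.exp_add, ← hy, neg_add_eq_sub]
  have hUz (z : ℝ) : transport T Θ L g t (Real.exp z • ξ)
      = Real.exp (-L (y + z)) • G (T (y + z) + t) := by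
    rw [transport, log_norm_exp_smul hξ, ← hy, hG, smul_smul, smul_smul, ← Real.exp_add,
      ← Real.exp_add, neg_add_eq_sub]
    congr 4
    ring
  have hGt := (hGd (T y + t)).hasDerivAt
  have h1 : HasDerivAt (fun t => transport T Θ L g t ξ)
      (Real.exp (-L y) • deriv G (T y + t)) t := by
    simp only [hU]
    exact (hGt.comp_const_add (T y) t).const_smul _
  have hshift : HasDerivAt (fun z : ℝ => y + z) 1 0 := (hasDerivAt_id 0).const_add y
  have hL0 : HasDerivAt L ((deriv C y / C y + n) / 2) (y + 0) := by rw [add_zero]; exact hL' y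
  have hT0 : HasDerivAt T (C y)⁻¹ (y + 0) := by rw [add_zero]; exact hT' y
  have hG0 : HasDerivAt G (deriv G (T y + t)) (T (y + 0) + t) := by rwa [add_zero]
  have h2 := ((hL0.comp 0 hshift).neg.exp).fun_smul
    (hG0.scomp 0 ((hT0.comp 0 hshift).add_const t))
  have h3 := fderiv_self_eq_of_hasDerivAt
    ((isTest_transport hT hΘ hL hTm hΘm hΘT hTΘ hg t).differentiableAt ξ)
    (h2.congr_of_eventuallyEq (Filter.Eventually.of_forall hUz))
  convert h1 using 1
  rw [radialGenerator, h3, hU t, ← hy]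
  have hC0 := (hpos y).ne'
  simp only [Function.comp_apply, add_zero, Pi.neg_apply]
  match_scalars
  · field_simp
  · field_simp
    ring

end Transport

/-! ### Differentiation under the integral sign -/

section Differentiation

variable {n : ℕ} {V : Type*} [NormedAddCommGroup V] [InnerProductSpace ℂ V]

/-- Differentiation under the integral of a smooth family of test functions against a locally
integrable function. -/
theorem hasDerivAt_integral_inner {w : E n → V} (hw : LocallyIntegrable w)
    {Γ Γ' : ℝ → E n → V}
    (hΓ : ContDiffOn ℝ ∞ (fun p : ℝ × E n => Γ p.1 p.2) (Set.univ ×ˢ {0}ᶜ))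
    (hsupp : ∀ t₀, ∃ a b : ℝ, 0 < a ∧ ∀ t ∈ Set.Icc (t₀ - 1) (t₀ + 1), ∀ ξ,
      Γ t ξ ≠ 0 → a ≤ ‖ξ‖ ∧ ‖ξ‖ ≤ b)
    (hΓ' : ∀ t ξ, HasDerivAt (fun t => Γ t ξ) (Γ' t ξ) t) (t₀ : ℝ) :
    HasDerivAt (fun t => ∫ ξ, inner ℂ (w ξ) (Γ t ξ)) (∫ ξ, inner ℂ (w ξ) (Γ' t₀ ξ)) t₀ := by
  obtain ⟨a, b, ha, hab⟩ := hsupp t₀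
  set A : Set (E n) := {ξ | a ≤ ‖ξ‖ ∧ ‖ξ‖ ≤ b} with hA
  have hAc : IsCompact A := by
    refine (isCompact_closedBall (0 : E n) b).of_isClosed_subset
      ((isClosed_le continuous_const continuous_norm).inter
        (isClosed_le continuous_norm continuous_const)) fun ξ hξ => ?_
    simpa using hξ.2
  have hA0 : A ⊆ {0}ᶜ := by
    rintro ξ hξ rfl
    have := hξ.1
    rw [norm_zero] at this
    exact absurd ha (not_lt.2 this)
  have hopen : IsOpen (Set.univ ×ˢ {0}ᶜ : Set (ℝ × E n)) :=
    isOpen_univ.prod isOpen_compl_singleton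
  -- The time derivative is a partial derivative of `Γ`, hence continuous.
  have hΓ'c : ContinuousOn (fun p : ℝ × E n => Γ' p.1 p.2) (Set.univ ×ˢ {0}ᶜ) := by
    have h1 : ContinuousOn (fun p : ℝ × E n =>
        fderiv ℝ (fun p : ℝ × E n => Γ p.1 p.2) p (1, 0)) (Set.univ ×ˢ {0}ᶜ) :=
      (hΓ.continuousOn_fderiv_of_isOpen hopen (by simp)).clm_apply continuousOn_const
    refine h1.congr fun p hp => ?_
    have hd : HasFDerivAt (fun p : ℝ × E n => Γ p.1 p.2) _ (p.1, p.2) :=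
      ((hΓ.contDiffAt (hopen.mem_nhds hp)).differentiableAt (by simp)).hasFDerivAt
    have hc : HasDerivAt (fun t : ℝ => (t, p.2)) ((1 : ℝ), (0 : E n)) p.1 :=
      (hasDerivAt_id p.1).prodMk (hasDerivAt_const p.1 p.2)
    exact (hΓ' p.1 p.2).unique
      (hd.comp_hasDerivAt (f := fun t : ℝ => (t, p.2)) p.1 hc)
  obtain ⟨B, hB⟩ := (isCompact_Icc (a := t₀ - 1) (b := t₀ + 1)).prod hAc
    |>.exists_bound_of_continuousOn (hΓ'c.mono (Set.prod_mono (Set.subset_univ _) hA0))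
  have hmem : t₀ ∈ Set.Icc (t₀ - 1) (t₀ + 1) := ⟨by linarith, by linarith⟩
  have hout : ∀ t ∈ Set.Ioo (t₀ - 1) (t₀ + 1), ∀ ξ, ξ ∉ A → Γ' t ξ = 0 := by
    intro t ht ξ hξ
    have he : (fun t => Γ t ξ) =ᶠ[nhds t] fun _ => 0 := by
      filter_upwards [isOpen_Ioo.mem_nhds ht] with s hs
      by_contra hne
      exact hξ (hab s ⟨hs.1.le, hs.2.le⟩ ξ hne)
    exact (hΓ' t ξ).unique ((hasDerivAt_const t (0 : V)).congr_of_eventuallyEq he)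
  have hmemo : t₀ ∈ Set.Ioo (t₀ - 1) (t₀ + 1) := ⟨by linarith, by linarith⟩
  have hmeas {F : E n → V} (hF : ContinuousOn F {0}ᶜ) (h0 : ∀ ξ, ξ ∉ A → F ξ = 0) :
      Continuous F := by
    rw [continuous_iff_continuousAt]
    intro ξ
    by_cases hξ : ξ = 0
    · have : F =ᶠ[nhds ξ] fun _ => 0 := by
        filter_upwards [hAc.isClosed.isOpen_compl.mem_nhds fun h => hA0 h hξ] with x hx
        exact h0 x hx
      exact continuousAt_const.congr this.symm
    · exact hF.continuousAt (isOpen_compl_singleton.mem_nhds hξ)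
  have hΓt (t : ℝ) (ht : t ∈ Set.Icc (t₀ - 1) (t₀ + 1)) : Continuous (Γ t) := by
    refine hmeas ?_ fun ξ hξ => by_contra fun hne => hξ (hab t ht ξ hne)
    exact hΓ.continuousOn.comp (f := fun ξ : E n => (t, ξ)) (by fun_prop) fun ξ hξ => ⟨trivial, hξ⟩
  have hΓ't : Continuous (Γ' t₀) := by
    refine hmeas ?_ (hout t₀ hmemo)
    exact hΓ'c.comp (f := fun ξ : E n => (t₀, ξ)) (by fun_prop) fun ξ hξ => ⟨trivial, hξ⟩
  have hwA : IntegrableOn w A := hw.integrableOn_isCompact hAc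
  have hint : Integrable (fun ξ => A.indicator (fun ξ => ‖w ξ‖ * B) ξ) :=
    (integrable_indicator_iff hAc.measurableSet).2 (hwA.norm.mul_const B)
  refine (hasDerivAt_integral_of_dominated_loc_of_deriv_le
    (F := fun t ξ => inner ℂ (w ξ) (Γ t ξ)) (F' := fun t ξ => inner ℂ (w ξ) (Γ' t ξ))
    (isOpen_Ioo.mem_nhds hmemo) ?_ ?_ ?_ ?_ hint ?_).2
  · filter_upwards [isOpen_Ioo.mem_nhds hmemo] with t ht
    exact hw.aestronglyMeasurable.inner (hΓt t ⟨ht.1.le, ht.2.le⟩).aestronglyMeasurable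
  · obtain ⟨B', hB'⟩ := hAc.exists_bound_of_continuousOn (hΓt t₀ hmem).continuousOn
    refine ((integrable_indicator_iff hAc.measurableSet).2 (hwA.norm.mul_const B')).mono'
      (hw.aestronglyMeasurable.inner (hΓt t₀ hmem).aestronglyMeasurable)
      (Filter.Eventually.of_forall fun ξ => ?_)
    by_cases hξ : ξ ∈ A
    · rw [Set.indicator_of_mem hξ]
      exact (norm_inner_le_norm _ _).trans
        (mul_le_mul_of_nonneg_left (hB' ξ hξ) (norm_nonneg _))
    · have : Γ t₀ ξ = 0 := by_contra fun hne => hξ (hab t₀ hmem ξ hne)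
      simp [this, Set.indicator_of_notMem hξ]
  · exact hw.aestronglyMeasurable.inner hΓ't.aestronglyMeasurable
  · refine Filter.Eventually.of_forall fun ξ t ht => ?_
    by_cases hξ : ξ ∈ A
    · rw [Set.indicator_of_mem hξ]
      exact (norm_inner_le_norm _ _).trans (mul_le_mul_of_nonneg_left
        (hB (t, ξ) ⟨⟨ht.1.le, ht.2.le⟩, hξ⟩) (norm_nonneg _))
    · simp [hout t ht ξ hξ, Set.indicator_of_notMem hξ]
  · refine Filter.Eventually.of_forall fun ξ t _ => ?_
    exact (((innerSL ℂ (w ξ)).restrictScalars ℝ).hasFDerivAt.comp_hasDerivAt t (hΓ' t ξ))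

end Differentiation

/-! ### The radial profile of the cutoff -/

section Profile

/-- The function `η(p) / |p|` at `|p| = 2 π exp y`. -/
def profile (h : ℝ → ℝ) (y : ℝ) : ℝ :=
  h (2 * Real.pi * Real.exp y) / (2 * Real.pi * Real.exp y)

theorem two_pi_exp_pos (y : ℝ) : 0 < 2 * Real.pi * Real.exp y := by positivity

namespace IsCutoff

variable {n : ℕ} {η : E n → ℝ} {h : ℝ → ℝ}

theorem eq_apply_smul (hη : IsCutoff η h) {e : E n} (he : ‖e‖ = 1) {r : ℝ} (hr : 0 ≤ r) :
    h r = η (r • e) := by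
  rw [hη.radial, norm_smul, he, mul_one, Real.norm_of_nonneg hr]

theorem contDiffAt (hη : IsCutoff η h) (hn : 0 < n) {r : ℝ} (hr : 0 < r) : ContDiffAt ℝ ∞ h r := by
  set e : E n := EuclideanSpace.single ⟨0, hn⟩ 1
  have he : ‖e‖ = 1 := by simp [e]
  have he0 : e ≠ 0 := norm_ne_zero_iff.1 (by rw [he]; exact one_ne_zero)
  have h1 : ContDiffAt ℝ ∞ η (r • e) :=
    hη.smooth.contDiffAt (isOpen_compl_singleton.mem_nhds (smul_ne_zero hr.ne' he0))
  have h2 : ContDiffAt ℝ ∞ (fun r : ℝ => r • e) r := contDiffAt_id.smul contDiffAt_const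
  refine (h1.comp r h2).congr_of_eventuallyEq ?_
  filter_upwards [isOpen_Ioi.mem_nhds hr] with s hs
  exact hη.eq_apply_smul he (le_of_lt hs)

theorem apply_half (hη : IsCutoff η h) (hn : 0 < n) : h (1 / 2) = 1 / 2 := by
  have h1 : Filter.Tendsto h (nhdsWithin (1 / 2) (Set.Iio (1 / 2))) (nhds (h (1 / 2))) :=
    (hη.contDiffAt hn (by norm_num)).continuousAt.tendsto.mono_left nhdsWithin_le_nhds
  have h2 : Filter.Tendsto h (nhdsWithin (1 / 2) (Set.Iio (1 / 2))) (nhds (1 / 2)) := by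
    refine (Filter.tendsto_id.mono_left nhdsWithin_le_nhds).congr' ?_
    filter_upwards [self_mem_nhdsWithin,
      nhdsWithin_le_nhds (isOpen_Ioi.mem_nhds (show (0 : ℝ) < 1 / 2 by norm_num))] with r hr hr0
    exact (hη.eq_self r ⟨le_of_lt hr0, hr⟩).symm
  exact tendsto_nhds_unique h1 h2

theorem half_le (hη : IsCutoff η h) (hn : 0 < n) {r : ℝ} (hr : 1 / 2 ≤ r) : 1 / 2 ≤ h r := by
  rcases lt_or_ge r 1 with h1 | h1
  · rw [← hη.apply_half hn]
    have := hη.monotone (a := 1 / 2) (b := r) ⟨le_rfl, by norm_num⟩ ⟨hr, h1⟩ hr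
    rwa [hη.apply_half hn] at this ⊢
  · rw [hη.eq_one r h1]; norm_num

theorem profile_contDiff (hη : IsCutoff η h) (hn : 0 < n) : ContDiff ℝ ∞ (profile h) := by
  rw [contDiff_iff_contDiffAt]
  intro y
  have h1 : ContDiffAt ℝ ∞ (fun y => 2 * Real.pi * Real.exp y) y :=
    (contDiff_const.mul Real.contDiff_exp).contDiffAt
  exact ((hη.contDiffAt hn (two_pi_exp_pos y)).comp y h1).div h1 (two_pi_exp_pos y).ne'

theorem profile_pos (hη : IsCutoff η h) (hn : 0 < n) (y : ℝ) : 0 < profile h y := by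
  refine div_pos ?_ (two_pi_exp_pos y)
  rcases lt_or_ge (2 * Real.pi * Real.exp y) (1 / 2) with h1 | h1
  · rw [hη.eq_self _ ⟨(two_pi_exp_pos y).le, h1⟩]
    exact two_pi_exp_pos y
  · exact (by norm_num : (0 : ℝ) < 1 / 2).trans_le (hη.half_le hn h1)

theorem profile_le (hη : IsCutoff η h) (y : ℝ) : profile h y ≤ 2 := by
  rw [profile, div_le_iff₀ (two_pi_exp_pos y)]
  rcases lt_or_ge (2 * Real.pi * Real.exp y) (1 / 2) with h1 | h1
  · rw [hη.eq_self _ ⟨(two_pi_exp_pos y).le, h1⟩]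
    linarith [two_pi_exp_pos y]
  · linarith [(hη.mem_Icc _ (two_pi_exp_pos y).le).2]

/-- The derivative of the profile is bounded: the profile is constant near `-∞` and a multiple of
`exp (-y)` near `+∞`. -/
theorem exists_abs_deriv_profile_le (hη : IsCutoff η h) (hn : 0 < n) :
    ∃ K, ∀ y, |deriv (profile h) y| ≤ K := by
  have hpi : 0 < 2 * Real.pi := by positivity
  have hcont : Continuous (deriv (profile h)) :=
    (contDiff_infty_iff_deriv.1 (hη.profile_contDiff hn)).2.continuous
  obtain ⟨K, hK⟩ := (isCompact_Icc (a := Real.log (1 / 2 / (2 * Real.pi)))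
    (b := Real.log (1 / (2 * Real.pi)))).exists_bound_of_continuousOn hcont.continuousOn
  refine ⟨max K 1, fun y => ?_⟩
  rcases lt_or_ge y (Real.log (1 / 2 / (2 * Real.pi))) with hy | hy
  · have he : profile h =ᶠ[nhds y] fun _ => 1 := by
      filter_upwards [isOpen_Iio.mem_nhds hy] with z hz
      have hz' : 2 * Real.pi * Real.exp z < 1 / 2 := by
        have := (Real.lt_log_iff_exp_lt (by positivity)).1 hz
        rw [lt_div_iff₀ hpi] at this
        linarith
      rw [profile, hη.eq_self _ ⟨(two_pi_exp_pos z).le, hz'⟩, div_self (two_pi_exp_pos z).ne']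
    rw [he.deriv_eq, deriv_const, abs_zero]
    exact le_max_of_le_right zero_le_one
  rcases le_or_gt y (Real.log (1 / (2 * Real.pi))) with hy' | hy'
  · exact le_max_of_le_left (hK y ⟨hy, hy'⟩)
  · have hlarge {z : ℝ} (hz : Real.log (1 / (2 * Real.pi)) < z) :
        1 < 2 * Real.pi * Real.exp z := by
      have := (Real.log_lt_iff_lt_exp (by positivity)).1 hz
      rw [div_lt_iff₀ hpi] at this
      linarith
    have he : profile h =ᶠ[nhds y] fun z => (2 * Real.pi)⁻¹ * Real.exp (-z) := by
      filter_upwards [isOpen_Ioi.mem_nhds hy'] with z hz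
      rw [profile, hη.eq_one _ (hlarge hz).le, Real.exp_neg]
      field_simp
    have hd : HasDerivAt (fun z => (2 * Real.pi)⁻¹ * Real.exp (-z))
        ((2 * Real.pi)⁻¹ * (Real.exp (-y) * -1)) y :=
      ((hasDerivAt_neg y).exp).const_mul _
    rw [he.deriv_eq, hd.deriv]
    refine le_max_of_le_right ?_
    have h1 := hlarge hy'
    have h2 : |(2 * Real.pi)⁻¹ * (Real.exp (-y) * -1)| = (2 * Real.pi * Real.exp y)⁻¹ := by
      rw [mul_neg_one, mul_neg, abs_neg, abs_of_pos (by positivity), Real.exp_neg]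
      field_simp
    rw [h2]
    exact inv_le_one_of_one_le₀ h1.le

theorem apply_two_pi_smul (hη : IsCutoff η h) {ξ : E n} (hξ : ξ ≠ 0) :
    η ((2 * Real.pi) • ξ) = 2 * Real.pi * ‖ξ‖ * profile h (Real.log ‖ξ‖) := by
  have hn : 0 < ‖ξ‖ := norm_pos_iff.2 hξ
  rw [hη.radial, norm_smul, Real.norm_of_nonneg (by positivity), profile, Real.exp_log hn,
    mul_div_cancel₀ _ (by positivity)]

end IsCutoff

end Profile

/-! ### The direction matrix -/

section Direction

variable {n N : ℕ}

/-- The matrix `α · ξ / |ξ|`. -/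
def directionMatrix (α : Fin (n + 1) → Matrix (Fin N) (Fin N) ℂ) (ξ : E n) :
    EuclideanSpace ℂ (Fin N) →L[ℂ] EuclideanSpace ℂ (Fin N) :=
  ∑ k : Fin n, ((ξ k / ‖ξ‖ : ℝ) : ℂ) • Matrix.toEuclideanCLM (n := Fin N) (𝕜 := ℂ) (α k.castSucc)

variable {α : Fin (n + 1) → Matrix (Fin N) (Fin N) ℂ}

theorem directionMatrix_smul {r : ℝ} (hr : 0 < r) (ξ : E n) :
    directionMatrix α (r • ξ) = directionMatrix α ξ := by
  refine Finset.sum_congr rfl fun k _ => ?_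
  rw [norm_smul, Real.norm_of_nonneg hr.le, PiLp.smul_apply, smul_eq_mul,
    mul_div_mul_left _ _ hr.ne']

theorem inner_directionMatrix (hα : IsDiracSystem α) (ξ : E n) (v w : EuclideanSpace ℂ (Fin N)) :
    inner ℂ (directionMatrix α ξ v) w = inner ℂ v (directionMatrix α ξ w) := by
  simp only [directionMatrix, sum_apply, sum_inner, inner_sum]
  refine Finset.sum_congr rfl fun k _ => ?_
  have hk : inner ℂ (Matrix.toEuclideanCLM (n := Fin N) (𝕜 := ℂ) (α k.castSucc) v) w
      = inner ℂ v (Matrix.toEuclideanCLM (n := Fin N) (𝕜 := ℂ) (α k.castSucc) w) := by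
    rw [← ContinuousLinearMap.adjoint_inner_right, ← ContinuousLinearMap.star_eq_adjoint,
      ← map_star, Matrix.star_eq_conjTranspose, (hα.1 k.castSucc).eq]
  simp only [smul_apply, inner_smul_left, inner_smul_right,
    hk, Complex.conj_ofReal]

theorem directionMatrix_directionMatrix (hα : IsDiracSystem α) {ξ : E n} (hξ : ξ ≠ 0)
    (v : EuclideanSpace ℂ (Fin N)) : directionMatrix α ξ (directionMatrix α ξ v) = v := by
  have hn : ‖ξ‖ ≠ 0 := norm_ne_zero_iff.2 hξ
  -- Symmetrise the double sum and use the anticommutation relations.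
  set a : Fin n → EuclideanSpace ℂ (Fin N) →L[ℂ] EuclideanSpace ℂ (Fin N) := fun k =>
    Matrix.toEuclideanCLM (n := Fin N) (𝕜 := ℂ) (α k.castSucc) with ha
  have hac (j k : Fin n) : a j * a k + a k * a j = if j = k then 2 • 1 else 0 := by
    rw [ha]
    dsimp only
    rw [← map_mul, ← map_mul, ← map_add, hα.2]
    by_cases hjk : j = k
    · rw [if_pos hjk, if_pos (by rw [hjk]), map_nsmul, map_one]
    · rw [if_neg hjk, if_neg (fun h => hjk (Fin.castSucc_injective n h)), map_zero]
  set r : Fin n → ℂ := fun k => ((ξ k / ‖ξ‖ : ℝ) : ℂ) with hr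
  have hr1 : ∑ k, r k * r k = 1 := by
    have h1 : ∑ k, ξ k / ‖ξ‖ * (ξ k / ‖ξ‖) = (∑ k, ξ k ^ 2) / ‖ξ‖ ^ 2 := by
      rw [Finset.sum_div]
      exact Finset.sum_congr rfl fun k _ => by field_simp
    rw [← EuclideanSpace.real_norm_sq_eq, div_self (pow_ne_zero 2 hn)] at h1
    rw [← Complex.ofReal_one, ← h1, Complex.ofReal_sum]
    exact Finset.sum_congr rfl fun k _ => (Complex.ofReal_mul _ _).symm
  have hsq : directionMatrix α ξ * directionMatrix α ξ = ∑ j, ∑ k, (r j * r k) • (a j * a k) := by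
    rw [directionMatrix, Finset.sum_mul_sum]
    refine Finset.sum_congr rfl fun j _ => Finset.sum_congr rfl fun k _ => ?_
    rw [smul_mul_smul_comm]
  have hsq' : directionMatrix α ξ * directionMatrix α ξ = ∑ j, ∑ k, (r j * r k) • (a k * a j) := by
    rw [hsq, Finset.sum_comm]
    refine Finset.sum_congr rfl fun j _ => Finset.sum_congr rfl fun k _ => ?_
    rw [mul_comm]
  have hac' (j k : Fin n) : (r j * r k) • (a j * a k) + (r j * r k) • (a k * a j)
      = if j = k then (r j * r k) • (2 • 1) else 0 := by
    refine (smul_add (r j * r k) (a j * a k) (a k * a j)).symm.trans ?_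
    rw [hac]
    by_cases hjk : j = k
    · rw [if_pos hjk, if_pos hjk]
    · rw [if_neg hjk, if_neg hjk, smul_zero]
  have h2 : directionMatrix α ξ * directionMatrix α ξ + directionMatrix α ξ * directionMatrix α ξ
      = 2 • 1 := by
    nth_rewrite 1 [hsq]
    rw [hsq', ← Finset.sum_add_distrib]
    simp only [← Finset.sum_add_distrib, hac', Finset.sum_ite_eq, Finset.mem_univ, if_true]
    rw [← Finset.sum_smul, hr1, one_smul]
  have h3 : (2 : ℂ) • directionMatrix α ξ (directionMatrix α ξ v) = (2 : ℂ) • v := by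
    rw [two_smul, two_smul]
    have := congrArg (fun L => L v) h2
    rw [two_smul] at this
    exact this
  exact smul_right_injective _ (two_ne_zero (α := ℂ)) h3

theorem norm_directionMatrix (hα : IsDiracSystem α) {ξ : E n} (hξ : ξ ≠ 0)
    (v : EuclideanSpace ℂ (Fin N)) : ‖directionMatrix α ξ v‖ = ‖v‖ := by
  have h : ‖directionMatrix α ξ v‖ ^ 2 = ‖v‖ ^ 2 := by
    rw [← inner_self_eq_norm_sq (𝕜 := ℂ), ← inner_self_eq_norm_sq (𝕜 := ℂ),
      inner_directionMatrix hα, directionMatrix_directionMatrix hα hξ]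
  exact (pow_left_inj₀ (norm_nonneg _) (norm_nonneg _) two_ne_zero).1 h

theorem IsTest.directionMatrix {g : E n → EuclideanSpace ℂ (Fin N)} (hg : IsTest g) :
    IsTest fun ξ => directionMatrix α ξ (g ξ) := by
  simp only [MasslessDirac.directionMatrix, sum_apply, smul_apply]
  refine IsTest.sum _ fun k _ => hg.of_eq_zero ?_ fun ξ h => by rw [h, map_zero, smul_zero]
  have h1 : ContDiffOn ℝ ∞ (fun ξ : E n => ξ k / ‖ξ‖) {0}ᶜ :=
    (EuclideanSpace.proj k : E n →L[ℝ] ℝ).contDiff.contDiffOn.div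
      (fun ξ hξ => (contDiffAt_norm ℝ hξ).contDiffWithinAt) fun ξ hξ => norm_ne_zero_iff.2 hξ
  have h2 : ContDiffOn ℝ ∞ (fun ξ : E n => ((ξ k / ‖ξ‖ : ℝ) : ℂ)) {0}ᶜ :=
    Complex.ofRealCLM.contDiff.comp_contDiffOn h1
  exact h2.smul (((Matrix.toEuclideanCLM (n := Fin N) (𝕜 := ℂ) (α k.castSucc)).restrictScalars
    ℝ).contDiff.comp_contDiffOn hg.1)

theorem IsTest.const_smul {V : Type*} [NormedAddCommGroup V] [NormedSpace ℂ V] {g : E n → V}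
    (hg : IsTest g) (c : ℂ) : IsTest fun ξ => c • g ξ :=
  hg.of_eq_zero (hg.contDiff.const_smul c).contDiffOn fun ξ h => by rw [h, smul_zero]

end Direction

/-! ### The conjugate operator on the Fourier side -/

section Symbol

variable {n N : ℕ} {α : Fin (n + 1) → Matrix (Fin N) (Fin N) ℂ} {η : E n → ℝ} {h : ℝ → ℝ}
  {f : L2 n N} {g : E n → EuclideanSpace ℂ (Fin N)}

theorem MapsToSymbol.congr {T : L2 n N →ₗ.[ℂ] L2 n N} {g₁ g₂ : E n → EuclideanSpace ℂ (Fin N)}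
    (hT : MapsToSymbol T f g₁) (hg : IsTest g₂) (he : ∀ ξ, ξ ≠ 0 → g₁ ξ = g₂ ξ) :
    MapsToSymbol T f g₂ := by
  obtain ⟨f', hf', hgr⟩ := hT
  exact ⟨f', hf'.congr hg he, hgr⟩

theorem IsTest.log_norm_smul {V : Type*} [NormedAddCommGroup V] [NormedSpace ℝ V] {g : E n → V}
    (hg : IsTest g) {C : ℝ → ℝ} (hC : ContDiff ℝ ∞ C) :
    IsTest fun ξ => C (Real.log ‖ξ‖) • g ξ :=
  hg.of_eq_zero ((hC.comp_contDiffOn contDiffOn_log_norm).smul hg.1)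
    fun ξ h => by rw [h, smul_zero]

/-- The matrix `α · ξ / |ξ|` is constant along rays, so that the Euler vector field does not
differentiate it. -/
theorem fderiv_self_log_norm_smul_directionMatrix (hg : IsTest g) {C : ℝ → ℝ}
    (hC : ContDiff ℝ ∞ C) {ξ : E n} (hξ : ξ ≠ 0) :
    fderiv ℝ (fun ζ : E n => C (Real.log ‖ζ‖) • directionMatrix α ζ (g ζ)) ξ ξ =
      directionMatrix α ξ
        (C (Real.log ‖ξ‖) • fderiv ℝ g ξ ξ + deriv C (Real.log ‖ξ‖) • g ξ) := by
  refine fderiv_self_eq_of_hasDerivAt ((hg.directionMatrix.log_norm_smul hC).differentiableAt ξ) ?_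
  have hexp : HasDerivAt (fun z : ℝ => Real.exp z • ξ) (Real.exp 0 • ξ) 0 :=
    (Real.hasDerivAt_exp 0).smul_const ξ
  have hg' : HasFDerivAt g (fderiv ℝ g ξ) (Real.exp 0 • ξ) := by
    rw [Real.exp_zero, one_smul]; exact (hg.differentiableAt ξ).hasFDerivAt
  have h1 := ((directionMatrix α ξ).restrictScalars ℝ).hasFDerivAt.comp_hasDerivAt 0
    (hg'.comp_hasDerivAt 0 hexp)
  have h2 : HasDerivAt C (deriv C (Real.log ‖ξ‖)) (Real.log ‖ξ‖ + 0) := by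
    rw [add_zero]; exact (hC.differentiable (by simp) _).hasDerivAt
  have h3 := (h2.comp 0 ((hasDerivAt_id 0).const_add _)).fun_smul h1
  have h4 (z : ℝ) : C (Real.log ‖Real.exp z • ξ‖) •
      directionMatrix α (Real.exp z • ξ) (g (Real.exp z • ξ)) =
      C (Real.log ‖ξ‖ + z) • directionMatrix α ξ (g (Real.exp z • ξ)) := by
    rw [log_norm_exp_smul hξ, directionMatrix_smul (Real.exp_pos z)]
  simp only [h4]
  refine h3.congr_deriv ?_
  simp only [Function.comp_apply, Real.exp_zero, one_smul, add_zero, mul_one, map_add,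
    ContinuousLinearMap.coe_restrictScalars', ← Complex.coe_smul, map_smul]

theorem HasSymbol.momentumDotPosition (hf : HasSymbol f g) :
    MapsToSymbol momentumDotPosition f fun ξ => Complex.I • fderiv ℝ g ξ ξ := by
  have h1 := MapsToSymbol.sum fun j : Fin n =>
    (hf.position j).opMul fun f' hf' => hf'.momentum j
  refine h1.congr (hf.1.fderiv_self.const_smul _) fun ξ _ => ?_
  rw [fderiv_self_eq_sum, Finset.smul_sum]
  refine Finset.sum_congr rfl fun j _ => ?_
  have : (Real.pi : ℂ) ≠ 0 := by simp [Real.pi_ne_zero]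
  rw [smul_smul, ← Complex.coe_smul (ξ j), smul_smul]
  congr 1
  push_cast
  field_simp

theorem fderiv_momentum_symbol (hg : IsTest g) (j : Fin n) (ξ v : E n) :
    (Complex.I / (2 * Real.pi)) •
      fderiv ℝ (fun ζ : E n => ((2 * Real.pi * ζ j : ℝ) : ℂ) • g ζ) ξ v =
      Complex.I • fderiv ℝ (fun ζ : E n => ζ j • g ζ) ξ v := by
  have h1 : (fun ζ : E n => ((2 * Real.pi * ζ j : ℝ) : ℂ) • g ζ)
      = fun ζ : E n => (2 * Real.pi) • (ζ j • g ζ) := by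
    ext1 ζ
    rw [Complex.coe_smul, mul_smul]
  have hd : DifferentiableAt ℝ (fun ζ : E n => ζ j • g ζ) ξ :=
    (EuclideanSpace.proj j : E n →L[ℝ] ℝ).differentiableAt.fun_smul (hg.differentiableAt ξ)
  have : (Real.pi : ℂ) ≠ 0 := by simp [Real.pi_ne_zero]
  rw [h1, fderiv_fun_const_smul hd, smul_apply, ← Complex.coe_smul, smul_smul]
  congr 1
  push_cast
  field_simp

/-- The additional `n` is the divergence of the Euler vector field. -/
theorem HasSymbol.positionDotMomentum (hf : HasSymbol f g) :
    MapsToSymbol positionDotMomentum f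
      fun ξ => Complex.I • (fderiv ℝ g ξ ξ + (n : ℝ) • g ξ) := by
  have h1 := MapsToSymbol.sum fun j : Fin n =>
    (hf.momentum j).opMul fun f' hf' => hf'.position j
  have hg : IsTest fun ξ => (n : ℝ) • g ξ :=
    hf.1.of_eq_zero (hf.1.contDiff.const_smul _).contDiffOn fun ξ h => by rw [h, smul_zero]
  refine h1.congr ((hf.1.fderiv_self.add hg).const_smul _) fun ξ _ => ?_
  rw [← sum_fderiv_coord_smul (hf.1.differentiableAt ξ), Finset.smul_sum]
  exact Finset.sum_congr rfl fun j _ => fderiv_momentum_symbol hf.1 j ξ _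

theorem IsTest.two_pi_norm_smul {V : Type*} [NormedAddCommGroup V] [NormedSpace ℝ V] {g : E n → V}
    (hg : IsTest g) : IsTest fun ξ => (2 * Real.pi * ‖ξ‖) • g ξ := by
  have h1 : ContDiffOn ℝ ∞ (fun ξ : E n => 2 * Real.pi * ‖ξ‖) {0}ᶜ :=
    contDiffOn_const.mul fun ξ hξ => (contDiffAt_norm ℝ hξ).contDiffWithinAt
  exact hg.of_eq_zero (h1.smul hg.1) fun ξ h => by rw [h, smul_zero]

theorem HasSymbol.dirac (hf : HasSymbol f g) :
    MapsToSymbol (dirac α) f fun ξ => (2 * Real.pi * ‖ξ‖) • directionMatrix α ξ (g ξ) := by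
  have h1 : MapsToSymbol (MasslessDirac.dirac α) f _ := MapsToSymbol.sum fun k : Fin n => by
    obtain ⟨f', hf', hgr⟩ := hf.momentum k
    exact ⟨_, hf'.matrixOp (α k.castSucc), mem_graph_compPMap _ hgr⟩
  refine h1.congr (hf.1.directionMatrix.two_pi_norm_smul) fun ξ hξ => ?_
  have hn : ‖ξ‖ ≠ 0 := norm_ne_zero_iff.2 hξ
  simp only [directionMatrix, sum_apply, smul_apply, Finset.smul_sum, map_smul]
  refine Finset.sum_congr rfl fun k _ => ?_
  rw [← Complex.coe_smul (2 * Real.pi * ‖ξ‖), smul_smul, ← Complex.ofReal_mul]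
  congr 2
  field_simp

theorem HasSymbol.cutoff (hη : IsCutoff η h) (hf : HasSymbol f g) :
    MapsToSymbol (MasslessDirac.momentumFn fun p => (η p : ℂ)) f
      fun ξ => (η ((2 * Real.pi) • ξ) : ℂ) • g ξ := by
  have h2 : ContDiffOn ℝ ∞ (fun ξ : E n => η ((2 * Real.pi) • ξ)) {0}ᶜ :=
    hη.smooth.comp (contDiff_const_smul _).contDiffOn fun ξ hξ =>
      smul_ne_zero (by positivity) hξ
  exact hf.momentumFn (m := fun p => (η p : ℂ)) (Complex.ofRealCLM.contDiff.comp_contDiffOn h2)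

theorem HasSymbol.invNegLaplacian (hf : HasSymbol f g) :
    MapsToSymbol invNegLaplacian f
      fun ξ => (((‖(2 * Real.pi) • ξ‖ ^ 2)⁻¹ : ℝ) : ℂ) • g ξ := by
  have h2 : ContDiffOn ℝ ∞ (fun ξ : E n => (‖(2 * Real.pi) • ξ‖ ^ 2)⁻¹) {0}ᶜ :=
    (contDiff_const_smul (2 * Real.pi)).norm_sq ℝ |>.contDiffOn.inv fun ξ hξ =>
      pow_ne_zero 2 (norm_ne_zero_iff.2 (smul_ne_zero (by positivity) hξ))
  exact hf.momentumFn (m := fun p => (((‖p‖ ^ 2)⁻¹ : ℝ) : ℂ))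
    (Complex.ofRealCLM.contDiff.comp_contDiffOn h2)

theorem two_pi_norm_mul_symbol (hη : IsCutoff η h) {ξ : E n} (hξ : ξ ≠ 0) :
    2 * Real.pi * ‖ξ‖ * ((‖(2 * Real.pi) • ξ‖ ^ 2)⁻¹ * η ((2 * Real.pi) • ξ))
      = profile h (Real.log ‖ξ‖) := by
  have hn : ‖ξ‖ ≠ 0 := norm_ne_zero_iff.2 hξ
  rw [hη.apply_two_pi_smul hξ, norm_smul, Real.norm_of_nonneg (by positivity)]
  field_simp

/-- On the Fourier side the conjugate operator is `i (α · ξ / |ξ|)` times the generator of the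
radial flow. -/
theorem HasSymbol.conjugateExpr (hη : IsCutoff η h) (hn : 0 < n) (hf : HasSymbol f g) :
    MapsToSymbol (conjugateExpr α η) f
      fun ξ => Complex.I • directionMatrix α ξ (radialGenerator (profile h) g ξ) := by
  have hC := hη.profile_contDiff hn
  have hg := hf.1
  have hw : IsTest fun ζ : E n => profile h (Real.log ‖ζ‖) • directionMatrix α ζ (g ζ) :=
    hg.directionMatrix.log_norm_smul hC
  have hA : MapsToSymbol (opMul (MasslessDirac.dirac α) (opMul MasslessDirac.invNegLaplacian
        (opMul (MasslessDirac.momentumFn fun p => (η p : ℂ)) MasslessDirac.momentumDotPosition))) f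
      fun ξ => Complex.I • (profile h (Real.log ‖ξ‖) • directionMatrix α ξ (fderiv ℝ g ξ ξ)) := by
    have h1 := ((hf.momentumDotPosition.opMul fun f' hf' => hf'.cutoff hη).opMul
      fun f' hf' => hf'.invNegLaplacian).opMul fun f' hf' => hf'.dirac (α := α)
    refine h1.congr ((hg.fderiv_self.directionMatrix.log_norm_smul hC).const_smul _) fun ξ hξ => ?_
    rw [← two_pi_norm_mul_symbol hη hξ]
    simp only [← Complex.coe_smul, map_smul, smul_smul]
    congr 1
    push_cast
    ring
  have hB : MapsToSymbol (opMul MasslessDirac.positionDotMomentum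
        (opMul MasslessDirac.invNegLaplacian
          (opMul (MasslessDirac.momentumFn fun p => (η p : ℂ)) (MasslessDirac.dirac α)))) f
      fun ξ => Complex.I •
        (fderiv ℝ (fun ζ : E n => profile h (Real.log ‖ζ‖) • directionMatrix α ζ (g ζ)) ξ ξ +
        (n : ℝ) • profile h (Real.log ‖ξ‖) • directionMatrix α ξ (g ξ)) := by
    have h1 := ((hf.dirac (α := α)).opMul fun f' hf' => hf'.cutoff hη).opMul
      fun f' hf' => hf'.invNegLaplacian
    refine (h1.congr hw fun ξ hξ => ?_).opMul fun f' hf' => hf'.positionDotMomentum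
    rw [← two_pi_norm_mul_symbol hη hξ]
    simp only [← Complex.coe_smul, smul_smul]
    congr 1
    push_cast
    ring
  rw [MasslessDirac.conjugateExpr]
  refine ((hA.add hB).smul (1 / 2 : ℂ)).congr
    ((hg.radialGenerator hC).directionMatrix.const_smul _) fun ξ hξ => ?_
  rw [fderiv_self_log_norm_smul_directionMatrix hg hC hξ, radialGenerator]
  simp only [← Complex.coe_smul, map_smul, map_add]
  push_cast
  module

end Symbol

/-! ### Skew-symmetry of the radial generator -/

section Symmetry

variable {n N : ℕ} {α : Fin (n + 1) → Matrix (Fin N) (Fin N) ℂ} {C : ℝ → ℝ}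
  {g g₁ g₂ : E n → EuclideanSpace ℂ (Fin N)}

theorem radialGenerator_directionMatrix (hg : IsTest g) {ξ : E n} (hξ : ξ ≠ 0) :
    radialGenerator C (fun ζ => directionMatrix α ζ (g ζ)) ξ =
      directionMatrix α ξ (radialGenerator C g ξ) := by
  have h1 := fderiv_self_log_norm_smul_directionMatrix (α := α) (C := fun _ => 1) hg
    contDiff_const hξ
  simp only [one_smul, deriv_const, zero_smul, add_zero] at h1
  rw [radialGenerator, radialGenerator, h1]
  simp only [← Complex.coe_smul, map_smul, map_add]

/-- The radial generator is skew-symmetric: `⟪R g₁, g₂⟫ + ⟪g₁, R g₂⟫` is the divergence of the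
vector field `C ⟪g₁, g₂⟫ ξ`. -/
theorem integral_inner_radialGenerator (hC : ContDiff ℝ ∞ C) (h₁ : IsTest g₁) (h₂ : IsTest g₂) :
    ∫ ξ, (inner ℂ (radialGenerator C g₁ ξ) (g₂ ξ) +
      inner ℂ (g₁ ξ) (radialGenerator C g₂ ξ)) = 0 := by
  have hi : IsTest fun ξ => inner ℂ (g₁ ξ) (g₂ ξ) :=
    h₁.of_eq_zero (h₁.contDiff.inner ℂ h₂.contDiff).contDiffOn
      fun ξ h => by rw [h, inner_zero_left]
  rw [← (hi.log_norm_smul hC).integral_fderiv_self_add]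
  refine integral_congr_ae ?_
  by_cases hn : n = 0
  · subst hn
    refine Filter.Eventually.of_forall fun ξ => ?_
    rw [Subsingleton.elim ξ 0]
    simp [h₁.eq_zero_at_zero, h₂.eq_zero_at_zero]
  have : Nonempty (Fin n) := Fin.pos_iff_nonempty.1 (Nat.pos_of_ne_zero hn)
  filter_upwards [compl_mem_ae_iff.2 (measure_singleton (0 : E n))] with ξ hξ
  have hy : HasFDerivAt (fun ζ : E n => C (Real.log ‖ζ‖))
      (fderiv ℝ (fun ζ : E n => C (Real.log ‖ζ‖)) ξ) ξ :=
    (((hC.comp_contDiffOn contDiffOn_log_norm).contDiffAt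
      (isOpen_compl_singleton.mem_nhds hξ)).differentiableAt (by simp)).hasFDerivAt
  have hray : fderiv ℝ (fun ζ : E n => C (Real.log ‖ζ‖)) ξ ξ = deriv C (Real.log ‖ξ‖) := by
    refine fderiv_self_eq_of_hasDerivAt hy.differentiableAt ?_
    have h2 : HasDerivAt C (deriv C (Real.log ‖ξ‖)) (Real.log ‖ξ‖ + 0) := by
      rw [add_zero]; exact (hC.differentiable (by simp) _).hasDerivAt
    have h3 := h2.comp 0 ((hasDerivAt_id 0).const_add (Real.log ‖ξ‖))
    rw [mul_one] at h3
    exact h3.congr_of_eventuallyEq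
      (Filter.Eventually.of_forall fun z => by simp [log_norm_exp_smul hξ])
  rw [(hy.fun_smul (hi.differentiableAt ξ).hasFDerivAt).fderiv]
  simp only [radialGenerator, add_apply, smul_apply, ContinuousLinearMap.smulRight_apply, hray,
    fderiv_inner_apply ℂ (h₁.differentiableAt ξ) (h₂.differentiableAt ξ)]
  simp only [← Complex.coe_smul, inner_add_left, inner_add_right, inner_smul_left,
    inner_smul_right, Complex.conj_ofReal, smul_eq_mul]
  push_cast
  ring

end Symmetry

/-! ### Weak solutions -/

section WeakSolutions

variable {n N : ℕ} {α : Fin (n + 1) → Matrix (Fin N) (Fin N) ℂ} {C : ℝ → ℝ}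
  {g : E n → EuclideanSpace ℂ (Fin N)}

theorem locallyIntegrable_L2 (u : L2 n N) : LocallyIntegrable u :=
  (Lp.memLp u).locallyIntegrable (by norm_num)

/-- Elements of `L²` are determined by their inner products with `𝒟₀`. -/
theorem eq_zero_of_inner_eq_zero (hn : 0 < n) (u : L2 n N)
    (h : ∀ f g, HasSymbol f g → inner ℂ u f = 0) : u = 0 := by
  have : Nonempty (Fin n) := Fin.pos_iff_nonempty.1 hn
  set v := fourierL2 u with hv
  have hloc := locallyIntegrable_L2 v
  have hae : ∀ᵐ ξ, ξ ∈ ({0}ᶜ : Set (E n)) → v ξ = 0 := by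
    refine isOpen_compl_singleton.ae_eq_zero_of_integral_contDiff_smul_eq_zero
      (hloc.locallyIntegrableOn _) fun φ hφ hc hsub => ?_
    -- Test against `φ c`, where `c` is the integral to be shown to vanish.
    set c := ∫ ξ, φ ξ • v ξ
    have hφt : IsTest φ := IsTest.of_contDiff hφ hc fun h0 => hsub h0 rfl
    have hg : IsTest fun ξ => φ ξ • c :=
      hφt.of_eq_zero (hφ.smul contDiff_const).contDiffOn fun ξ h0 => by rw [h0, zero_smul]
    obtain ⟨f, hf⟩ := hg.exists_hasSymbol
    have h0 := h f _ hf
    rw [hf.inner_right] at h0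
    have hint : Integrable fun ξ => φ ξ • v ξ := by
      have := hloc.integrable_smul_left_of_hasCompactSupport hφ.continuous hc
      exact this
    have h1 : inner ℂ c c = 0 := by
      calc inner ℂ c c = ∫ ξ, inner ℂ c (φ ξ • v ξ) := (integral_inner hint c).symm
        _ = ∫ ξ, (starRingEnd ℂ) (inner ℂ (v ξ) (φ ξ • c)) := by
          refine integral_congr_ae (Filter.Eventually.of_forall fun ξ => ?_)
          simp only [← Complex.coe_smul, inner_smul_right, map_mul, Complex.conj_ofReal,
            inner_conj_symm]
        _ = 0 := by rw [integral_conj, h0, map_zero]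
    exact inner_self_eq_zero.1 h1
  have hv0 : v = 0 := by
    refine (Lp.eq_zero_iff_ae_eq_zero).2 ?_
    filter_upwards [hae, compl_mem_ae_iff.2 (measure_singleton (0 : E n))] with ξ h1 h2
    exact h1 h2
  exact fourierL2.map_eq_zero_iff.1 hv0

/-- A bounded solution of `φ' = κ φ` on the whole line vanishes, for real `κ ≠ 0`. -/
theorem eq_zero_of_hasDerivAt_of_bounded {φ : ℝ → ℂ} {κ : ℝ} (hκ : κ ≠ 0)
    (hφ : ∀ t, HasDerivAt φ (κ * φ t) t) {B : ℝ} (hB : ∀ t, ‖φ t‖ ≤ B) : φ 0 = 0 := by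
  set F : ℝ → ℂ := fun t => (Real.exp (-(κ * t)) : ℂ) * φ t with hF
  have hF' (t : ℝ) : HasDerivAt F 0 t := by
    have h1 : HasDerivAt (fun t : ℝ => Real.exp (-(κ * t))) (Real.exp (-(κ * t)) * -(κ * 1)) t :=
      ((hasDerivAt_id t).const_mul κ).neg.exp
    have h2 := h1.ofReal_comp.mul (hφ t)
    refine h2.congr_deriv ?_
    push_cast
    ring
  have hconst (t : ℝ) : F t = F 0 :=
    is_const_of_deriv_eq_zero (fun t => (hF' t).differentiableAt) (fun t => (hF' t).deriv) t 0
  have hle (t : ℝ) : ‖φ 0‖ ≤ Real.exp (-(κ * t)) * B := by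
    have h1 : F 0 = φ 0 := by simp [hF]
    rw [← h1, ← hconst t, hF]
    dsimp only
    rw [norm_mul, Complex.norm_real, Real.norm_of_nonneg (Real.exp_pos _).le]
    exact mul_le_mul_of_nonneg_left (hB t) (Real.exp_pos _).le
  have hlim : Filter.Tendsto (fun s : ℝ => Real.exp (-(κ * (s / κ))) * B) Filter.atTop
      (nhds (0 * B)) := by
    refine Filter.Tendsto.mul_const B ?_
    simp only [mul_div_cancel₀ _ hκ]
    exact Real.tendsto_exp_neg_atTop_nhds_zero
  rw [zero_mul] at hlim
  exact norm_le_zero_iff.1 (ge_of_tendsto' hlim fun s => hle _)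

theorem directionMatrix_transport {T Θ L : ℝ → ℝ} {c : ℂ}
    (h : ∀ ξ, directionMatrix α ξ (g ξ) = c • g ξ) (t : ℝ) (ξ : E n) :
    directionMatrix α ξ (transport T Θ L g t ξ) = c • transport T Θ L g t ξ := by
  rw [transport, ← Complex.coe_smul, map_smul,
    ← directionMatrix_smul (Real.exp_pos (Θ (T (Real.log ‖ξ‖) + t) - Real.log ‖ξ‖)) ξ, h,
    smul_comm]

/-- A weak solution `u` of the eigenvalue equation with nonreal eigenvalue is orthogonal to the
test functions on which `α · ξ / |ξ|` acts as a sign: its inner product with the transported test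
function solves `φ' = ±φ` and stays bounded, because the transport is isometric. -/
theorem integral_inner_eq_zero_of_eigen (hC : ContDiff ℝ ∞ C)
    (hpos : ∀ y, 0 < C y) {K : ℝ} (hK : ∀ y, C y ≤ K) (u : L2 n N) {μ ε : ℝ} (hμ : μ ≠ 0)
    (hε : ε * ε = 1)
    (hu : ∀ g, IsTest g → ∫ ξ, inner ℂ (fourierL2 u ξ)
      (Complex.I • directionMatrix α ξ (radialGenerator C g ξ)) =
        -(μ * Complex.I) * ∫ ξ, inner ℂ (fourierL2 u ξ) (g ξ))
    (hg : IsTest g) (hσ : ∀ ξ, directionMatrix α ξ (g ξ) = (ε : ℂ) • g ξ) :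
    ∫ ξ, inner ℂ (fourierL2 u ξ) (g ξ) = 0 := by
  obtain ⟨T, Θ, hT, hΘ, hT', hTm, hΘm, hΘT, hTΘ⟩ := exists_time_function hC hpos hK
  have hC' : ContDiff ℝ ∞ (deriv C) := (contDiff_infty_iff_deriv.1 hC).2
  set L : ℝ → ℝ := fun y => (Real.log (C y) + n * y) / 2 with hL
  have hLs : ContDiff ℝ ∞ L :=
    ((hC.log fun y => (hpos y).ne').add (contDiff_const.mul contDiff_id)).div_const 2
  have hL' (y : ℝ) : HasDerivAt L ((deriv C y / C y + n) / 2) y := by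
    have h1 := ((hC.differentiable (by simp) y).hasDerivAt.log (hpos y).ne').add
      ((hasDerivAt_id y).const_mul (n : ℝ))
    rw [mul_one] at h1
    exact h1.div_const 2
  set G : ℝ → E n → EuclideanSpace ℂ (Fin N) := transport T Θ L g with hG
  have hGt (t : ℝ) : IsTest (G t) := isTest_transport hT hΘ hLs hTm hΘm hΘT hTΘ hg t
  have hGs := contDiffOn_transport hT hΘ hLs hg.contDiff
  have hGd (t : ℝ) (ξ : E n) : HasDerivAt (fun t => G t ξ) (radialGenerator C (G t) ξ) t :=
    hasDerivAt_transport hpos hT hT' hΘ hLs hL' hTm hΘm hΘT hTΘ hg t ξ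
  have hGsupp := transport_support (L := L) hTm hΘm hΘT hTΘ hg
  -- `σ` acts as `ε` on `R (U_t g)` as well, since this is the time derivative of `U_t g`.
  have hRσ (t : ℝ) (ξ : E n) : directionMatrix α ξ (radialGenerator C (G t) ξ)
      = (ε : ℂ) • radialGenerator C (G t) ξ := by
    have h1 := ((directionMatrix α ξ).restrictScalars ℝ).hasFDerivAt.comp_hasDerivAt t (hGd t ξ)
    refine h1.unique (((hGd t ξ).const_smul (ε : ℂ)).congr_of_eventuallyEq
      (Filter.Eventually.of_forall fun s => ?_))
    exact directionMatrix_transport hσ s ξ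
  choose f hf using fun t => (hGt t).exists_hasSymbol
  have hnorm (t : ℝ) : ‖f t‖ = ‖f 0‖ := by
    -- The squared norm is written as an integral of the form `∫ ⟪1, Γ t ξ⟫`.
    have hd (t : ℝ) : HasDerivAt (fun t => ∫ ξ, inner ℂ (1 : ℂ) (inner ℂ (G t ξ) (G t ξ))) 0 t := by
      refine (hasDerivAt_integral_inner (w := fun _ => (1 : ℂ)) (locallyIntegrable_const 1)
        (Γ := fun t ξ => inner ℂ (G t ξ) (G t ξ))
        (Γ' := fun t ξ => inner ℂ (G t ξ) (radialGenerator C (G t) ξ) +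
          inner ℂ (radialGenerator C (G t) ξ) (G t ξ)) (hGs.inner ℂ hGs) (fun t₀ => ?_)
        (fun t ξ => (hGd t ξ).inner ℂ (hGd t ξ)) t).congr_deriv ?_
      · obtain ⟨a, b, ha, hab⟩ := hGsupp t₀
        exact ⟨a, b, ha, fun t ht ξ hξ => hab t ht ξ fun h0 => hξ (by
          change G t ξ = 0 at h0
          simp only [h0, inner_zero_left])⟩
      · rw [← integral_inner_radialGenerator hC (hGt t) (hGt t)]
        refine integral_congr_ae (Filter.Eventually.of_forall fun ξ => ?_)
        simp [add_comm]
    have hconst := is_const_of_deriv_eq_zero (fun t => (hd t).differentiableAt)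
      (fun t => (hd t).deriv) t 0
    simp only [RCLike.inner_apply, map_one, mul_one] at hconst
    rw [← (hf t).inner_eq (hf t), ← (hf 0).inner_eq (hf 0), inner_self_eq_norm_sq_to_K,
      inner_self_eq_norm_sq_to_K] at hconst
    have h2 : ‖f t‖ ^ 2 = ‖f 0‖ ^ 2 := by exact_mod_cast hconst
    exact (pow_left_inj₀ (norm_nonneg _) (norm_nonneg _) two_ne_zero).1 h2
  have hφ (t : ℝ) : HasDerivAt (fun t => ∫ ξ, inner ℂ (fourierL2 u ξ) (G t ξ))
      ((-(ε * μ) : ℝ) * ∫ ξ, inner ℂ (fourierL2 u ξ) (G t ξ)) t := by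
    refine (hasDerivAt_integral_inner (locallyIntegrable_L2 _) hGs hGsupp hGd t).congr_deriv ?_
    have h1 := hu (G t) (hGt t)
    simp only [hRσ, inner_smul_right, integral_const_mul] at h1
    have h2 : (ε : ℂ) * ε = 1 := by exact_mod_cast congrArg (fun x : ℝ => (x : ℂ)) hε
    push_cast
    generalize (∫ ξ, inner ℂ (fourierL2 u ξ) (radialGenerator C (G t) ξ)) = X at h1 ⊢
    generalize (∫ ξ, inner ℂ (fourierL2 u ξ) (G t ξ)) = Y at h1 ⊢
    linear_combination (-Complex.I * ε) * h1 - X * h2 + (X * ε * ε + ε * μ * Y) * Complex.I_mul_I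
  have hε0 : ε ≠ 0 := by rintro rfl; simp at hε
  have h0 := eq_zero_of_hasDerivAt_of_bounded (neg_ne_zero.2 (mul_ne_zero hε0 hμ)) hφ
    (B := ‖u‖ * ‖f 0‖) fun t => by
      rw [← (hf t).inner_right, ← hnorm t]
      exact norm_inner_le_norm _ _
  rwa [hG, transport_zero_time hΘT] at h0

end WeakSolutions

/-! ### Essential self-adjointness -/

section ConjugateOperator

variable {n N : ℕ} {α : Fin (n + 1) → Matrix (Fin N) (Fin N) ℂ} {η : E n → ℝ} {h : ℝ → ℝ}
  {f : L2 n N} {g : E n → EuclideanSpace ℂ (Fin N)}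

/-- The symbol `i σ R` of the conjugate operator is symmetric: `R` is skew-symmetric and commutes
with the self-adjoint `σ`. -/
theorem integral_inner_I_smul_directionMatrix (hα : IsDiracSystem α) {C : ℝ → ℝ}
    (hC : ContDiff ℝ ∞ C)
    {g₁ g₂ : E n → EuclideanSpace ℂ (Fin N)} (h₁ : IsTest g₁) (h₂ : IsTest g₂) :
    ∫ ξ, inner ℂ (Complex.I • directionMatrix α ξ (radialGenerator C g₁ ξ)) (g₂ ξ) =
      ∫ ξ, inner ℂ (g₁ ξ) (Complex.I • directionMatrix α ξ (radialGenerator C g₂ ξ)) := by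
  have hi {w₁ w₂ : E n → EuclideanSpace ℂ (Fin N)} (h₁ : IsTest w₁) (h₂ : IsTest w₂) :
      Integrable fun ξ => inner ℂ (w₁ ξ) (w₂ ξ) :=
    (h₁.of_eq_zero (h₁.contDiff.inner ℂ h₂.contDiff).contDiffOn
      fun ξ h => by rw [h, inner_zero_left]).integrable
  rw [← sub_eq_zero, ← integral_sub
    (hi ((h₁.radialGenerator hC).directionMatrix.const_smul _) h₂)
    (hi h₁ ((h₂.radialGenerator hC).directionMatrix.const_smul _))]
  have h0 := integral_inner_radialGenerator hC h₁ (h₂.directionMatrix (α := α))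
  rw [← mul_zero (-Complex.I), ← h0, ← integral_const_mul]
  refine integral_congr_ae (Filter.Eventually.of_forall fun ξ => ?_)
  by_cases hξ : ξ = 0
  · subst hξ
    simp [h₁.eq_zero_at_zero, h₂.eq_zero_at_zero]
  · simp only [radialGenerator_directionMatrix h₂ hξ, inner_smul_left, inner_smul_right,
      Complex.conj_I, inner_directionMatrix hα]
    ring

theorem conjugateOp_domain (hη : IsCutoff η h) (hn : 0 < n) :
    (conjugateOp (N := N) α η).domain = D0 n N := by
  rw [conjugateOp, LinearPMap.domRestrict_domain]
  refine inf_eq_left.2 fun f hf => ?_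
  obtain ⟨g, hg⟩ := mem_D0_iff.1 hf
  obtain ⟨f', -, hgr⟩ := hg.conjugateExpr (α := α) hη hn
  exact LinearPMap.mem_domain_of_mem_graph hgr

theorem conjugateOp_hasSymbol (hη : IsCutoff η h) (hn : 0 < n) (x : (conjugateOp α η).domain)
    (hx : HasSymbol (x : L2 n N) g) :
    HasSymbol (conjugateOp α η x)
      fun ξ => Complex.I • directionMatrix α ξ (radialGenerator (profile h) g ξ) := by
  obtain ⟨f', hf', hgr⟩ := hx.conjugateExpr (α := α) hη hn
  have hle : conjugateOp (N := N) α η ≤ conjugateExpr α η := LinearPMap.domRestrict_le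
  have h1 := LinearPMap.le_graph_of_le hle ((conjugateOp α η).mem_graph x)
  rwa [LinearPMap.mem_graph_snd_inj _ h1 hgr rfl]

theorem exists_hasSymbol_of_mem (hη : IsCutoff η h) (hn : 0 < n)
    (x : (conjugateOp (N := N) α η).domain) : ∃ g, HasSymbol (x : L2 n N) g :=
  mem_D0_iff.1 (conjugateOp_domain (α := α) hη hn ▸ x.2)

theorem dense_D0 (hn : 0 < n) : Dense (D0 n N : Set (L2 n N)) := by
  rw [Submodule.dense_iff_topologicalClosure_eq_top, Submodule.topologicalClosure_eq_top_iff,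
    Submodule.eq_bot_iff]
  intro u hu
  rw [Submodule.mem_orthogonal'] at hu
  exact eq_zero_of_inner_eq_zero hn u fun f g hf => hu f (mem_D0_iff.2 ⟨g, hf⟩)

theorem conjugateOp_isFormalAdjoint (hα : IsDiracSystem α) (hη : IsCutoff η h) (hn : 0 < n) :
    (conjugateOp (N := N) α η).IsFormalAdjoint (conjugateOp α η) := by
  intro x y
  obtain ⟨g₁, h₁⟩ := exists_hasSymbol_of_mem hη hn x
  obtain ⟨g₂, h₂⟩ := exists_hasSymbol_of_mem hη hn y
  rw [(conjugateOp_hasSymbol hη hn x h₁).inner_eq h₂,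
    h₁.inner_eq (conjugateOp_hasSymbol hη hn y h₂)]
  exact integral_inner_I_smul_directionMatrix hα (hη.profile_contDiff hn) h₁.1 h₂.1

/-- The deficiency subspaces of the conjugate operator are trivial. A test function is the sum of
two test functions on which `α · ξ / |ξ|` acts as `1` and as `-1`. -/
theorem eq_zero_of_inner_conjugateOp (hα : IsDiracSystem α) (hη : IsCutoff η h) (hn : 0 < n)
    (u : L2 n N) {μ : ℝ} (hμ : μ ≠ 0)
    (hu : ∀ x : (conjugateOp α η).domain,
      inner ℂ u (conjugateOp α η x + (μ * Complex.I) • (x : L2 n N)) = 0) : u = 0 := by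
  have hC := hη.profile_contDiff hn
  have hweak : ∀ g, IsTest g → ∫ ξ, inner ℂ (fourierL2 u ξ)
      (Complex.I • directionMatrix α ξ (radialGenerator (profile h) g ξ)) =
        -(μ * Complex.I) * ∫ ξ, inner ℂ (fourierL2 u ξ) (g ξ) := by
    intro g hg
    obtain ⟨f, hf⟩ := hg.exists_hasSymbol
    have hfd : f ∈ (conjugateOp α η).domain :=
      conjugateOp_domain (α := α) hη hn ▸ mem_D0_iff.2 ⟨g, hf⟩
    have h1 := hu ⟨f, hfd⟩
    rw [inner_add_right, inner_smul_right,
      (conjugateOp_hasSymbol hη hn ⟨f, hfd⟩ hf).inner_right, hf.inner_right] at h1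
    rw [eq_neg_of_add_eq_zero_left h1, neg_mul]
  have heigen {ε : ℝ} (hε : ε * ε = 1) {g : E n → EuclideanSpace ℂ (Fin N)} (hg : IsTest g)
      (hσ : ∀ ξ, directionMatrix α ξ (g ξ) = (ε : ℂ) • g ξ) :
      ∫ ξ, inner ℂ (fourierL2 u ξ) (g ξ) = 0 :=
    integral_inner_eq_zero_of_eigen hC (hη.profile_pos hn) hη.profile_le u hμ hε hweak hg hσ
  refine eq_zero_of_inner_eq_zero hn u fun f g hf => ?_
  have hpart {ε : ℝ} (hε : ε * ε = 1) :
      IsTest (fun ξ => (1 / 2 : ℂ) • (g ξ + (ε : ℂ) • directionMatrix α ξ (g ξ))) ∧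
      ∀ ξ, directionMatrix α ξ ((1 / 2 : ℂ) • (g ξ + (ε : ℂ) • directionMatrix α ξ (g ξ)))
        = (ε : ℂ) • ((1 / 2 : ℂ) • (g ξ + (ε : ℂ) • directionMatrix α ξ (g ξ))) := by
    refine ⟨(hf.1.add (hf.1.directionMatrix.const_smul _)).const_smul _, fun ξ => ?_⟩
    by_cases hξ : ξ = 0
    · subst hξ
      simp [hf.1.eq_zero_at_zero]
    · have h2 : (ε : ℂ) * ε = 1 := by exact_mod_cast congrArg (fun x : ℝ => (x : ℂ)) hε
      rw [map_smul, map_add, map_smul, directionMatrix_directionMatrix hα hξ, smul_comm (ε : ℂ),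
        smul_add (ε : ℂ), smul_smul (ε : ℂ), h2, one_smul, add_comm]
  obtain ⟨hp1, hp2⟩ := hpart (ε := 1) (by norm_num)
  obtain ⟨hm1, hm2⟩ := hpart (ε := -1) (by norm_num)
  obtain ⟨fp, hfp⟩ := hp1.exists_hasSymbol
  obtain ⟨fm, hfm⟩ := hm1.exists_hasSymbol
  have hsum : f = fp + fm := hf.unique ((hfp.add hfm).congr hf.1 fun ξ _ => by
    push_cast
    module)
  rw [hsum, inner_add_right, hfp.inner_right, hfm.inner_right, heigen (by norm_num) hp1 hp2,
    heigen (by norm_num) hm1 hm2, add_zero]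

theorem conjugateOp_closure_eq_adjoint (hα : IsDiracSystem α) (hη : IsCutoff η h) (hn : 0 < n) :
    (conjugateOp (N := N) α η).closure = (conjugateOp α η).adjoint := by
  refine closure_eq_adjoint ?_ (conjugateOp_isFormalAdjoint hα hη hn) (fun u hu => ?_)
    fun u hu => ?_
  · rw [conjugateOp_domain hη hn]; exact dense_D0 hn
  · exact eq_zero_of_inner_conjugateOp hα hη hn u one_ne_zero fun x => by
      rw [Complex.ofReal_one, one_mul]
      exact hu x
  · exact eq_zero_of_inner_conjugateOp hα hη hn u (neg_ne_zero.2 one_ne_zero) fun x => by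
      rw [Complex.ofReal_neg, Complex.ofReal_one, neg_one_mul, neg_smul, ← sub_eq_add_neg]
      exact hu x

end ConjugateOperator

/-! ### The weighted space -/

section WeightedSpace

variable {n N : ℕ} {α : Fin (n + 1) → Matrix (Fin N) (Fin N) ℂ} {η : E n → ℝ} {h : ℝ → ℝ}

theorem exists_mem_graph_position {u : L2 n N} (hu : u ∈ weightedL2 n N 1) (j : Fin n) :
    ∃ v, (u, v) ∈ (position j).graph := by
  obtain ⟨w, hw⟩ := LinearPMap.mem_domain_iff.1 hu
  rw [mem_graph_mulOp] at hw
  have hc : Continuous fun x : E n => ((x j : ℝ) : ℂ) :=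
    Complex.continuous_ofReal.comp (EuclideanSpace.proj j : E n →L[ℝ] ℝ).continuous
  have hmeas : AEStronglyMeasurable (fun x : E n => ((x j : ℝ) : ℂ) • u x) :=
    hc.aestronglyMeasurable.smul (Lp.aestronglyMeasurable u)
  have hmem : MemLp (fun x : E n => ((x j : ℝ) : ℂ) • u x) 2 := by
    refine (Lp.memLp w).mono hmeas ?_
    filter_upwards [hw] with x hx
    rw [hx, norm_smul, norm_smul, Complex.norm_real, Complex.norm_real, Real.rpow_one]
    refine mul_le_mul_of_nonneg_right ?_ (norm_nonneg _)
    rw [Real.norm_of_nonneg (Real.sqrt_nonneg _)]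
    refine (PiLp.norm_apply_le x j).trans (Real.le_sqrt_of_sq_le ?_)
    linarith
  exact ⟨hmem.toLp _, (mem_graph_mulOp _ _ _).2 hmem.coeFn_toLp⟩

theorem inner_position {a a' b b' : L2 n N} {j : Fin n} (ha : (a, a') ∈ (position j).graph)
    (hb : (b, b') ∈ (position j).graph) : inner ℂ a b' = inner ℂ a' b := by
  rw [position, mem_graph_mulOp] at ha hb
  rw [L2.inner_def, L2.inner_def]
  refine integral_congr_ae ?_
  filter_upwards [ha, hb] with x h1 h2
  rw [h1, h2, inner_smul_left, inner_smul_right, Complex.conj_ofReal]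

/-- With all derivatives moved to the left, `A = ∑_j Q_j B_j - B` for the bounded Fourier
multipliers `B_j = 2π ξ_j c σ` and `B = (i / 2) (ξ · ∇ c + n c) σ`; here `ψ_j = B_j x`,
`θ_j = Q_j ψ_j` and `β = B x`. -/
theorem exists_decomposition (hα : IsDiracSystem α) (hη : IsCutoff η h) (hn : 0 < n) {K : ℝ}
    (hK : ∀ y, |deriv (profile h) y| ≤ K) (x : (conjugateOp (N := N) α η).domain) :
    ∃ (ψ θ : Fin n → L2 n N) (β : L2 n N), (∀ j, (ψ j, θ j) ∈ (position j).graph) ∧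
      conjugateOp α η x = ∑ j, θ j - β ∧ (∀ j, ‖ψ j‖ ≤ 1 * ‖(x : L2 n N)‖) ∧
      ‖β‖ ≤ ((K + n * 2) / 2) * ‖(x : L2 n N)‖ := by
  have hC := hη.profile_contDiff hn
  have hC' : ContDiff ℝ ∞ (deriv (profile h)) := (contDiff_infty_iff_deriv.1 hC).2
  obtain ⟨g, hx⟩ := exists_hasSymbol_of_mem hη hn x
  have hg := hx.1
  have hw : IsTest fun ξ : E n => profile h (Real.log ‖ξ‖) • directionMatrix α ξ (g ξ) :=
    hg.directionMatrix.log_norm_smul hC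
  obtain ⟨fw, hfw⟩ := hw.exists_hasSymbol
  choose ψ hψ hψg using fun j => hfw.momentum j
  choose θ hθ hθg using fun j => (hψ j).position j
  have hβt := (hg.directionMatrix (α := α)).log_norm_smul
    (C := fun y => (deriv (profile h) y + n * profile h y) / 2)
    ((hC'.add (contDiff_const.mul hC)).div_const 2)
  obtain ⟨β, hβ⟩ := (hβt.const_smul Complex.I).exists_hasSymbol
  refine ⟨ψ, θ, β, hθg, ?_, fun j => hx.norm_le (hψ j) fun ξ => ?_, hx.norm_le hβ fun ξ => ?_⟩
  · have hA := conjugateOp_hasSymbol hη hn x hx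
    refine eq_sub_of_add_eq ((hA.add hβ).unique ((HasSymbol.sum _ fun j _ => hθ j).congr
      (hA.add hβ).1 fun ξ hξ => ?_))
    simp only [fderiv_momentum_symbol hw]
    rw [← Finset.smul_sum, sum_fderiv_coord_smul (hw.differentiableAt ξ),
      fderiv_self_log_norm_smul_directionMatrix hg hC hξ, radialGenerator]
    simp only [← Complex.coe_smul, map_smul, map_add]
    push_cast
    module
  · by_cases hξ : ξ = 0
    · subst hξ
      simp [hg.eq_zero_at_zero]
    have hpos := hη.profile_pos hn (Real.log ‖ξ‖)
    rw [norm_smul, norm_smul, norm_directionMatrix hα hξ, Complex.norm_real,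
      Real.norm_of_nonneg hpos.le, norm_mul, Real.norm_of_nonneg (by positivity), ← mul_assoc]
    refine mul_le_mul_of_nonneg_right ?_ (norm_nonneg _)
    have h1 : η ((2 * Real.pi) • ξ) ≤ 1 := by
      rw [hη.radial]; exact (hη.mem_Icc _ (norm_nonneg _)).2
    rw [hη.apply_two_pi_smul hξ] at h1
    refine le_trans ?_ h1
    have h2 : ‖ξ j‖ ≤ ‖ξ‖ := PiLp.norm_apply_le ξ j
    gcongr
  · by_cases hξ : ξ = 0
    · subst hξ
      simp [hg.eq_zero_at_zero]
    rw [norm_smul, norm_smul, norm_directionMatrix hα hξ, Complex.norm_I, one_mul,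
      Real.norm_eq_abs, abs_div, abs_two]
    refine mul_le_mul_of_nonneg_right ?_ (norm_nonneg _)
    gcongr
    refine (abs_add_le _ _).trans (add_le_add (hK _) ?_)
    rw [abs_mul, Nat.abs_cast, abs_of_pos (hη.profile_pos hn _)]
    gcongr
    exact hη.profile_le _

theorem weightedL2_le_adjoint_domain (hα : IsDiracSystem α) (hη : IsCutoff η h) (hn : 0 < n) :
    weightedL2 n N 1 ≤ (conjugateOp α η).adjoint.domain := by
  intro u hu
  obtain ⟨K, hK⟩ := hη.exists_abs_deriv_profile_le hn
  choose v hv using exists_mem_graph_position hu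
  rw [LinearPMap.mem_adjoint_domain_iff]
  refine AddMonoidHomClass.continuous_of_bound _
    (∑ j, ‖v j‖ + ‖u‖ * ((K + n * 2) / 2)) fun x => ?_
  obtain ⟨ψ, θ, β, hψ, hA, hψn, hβn⟩ := exists_decomposition hα hη hn hK x
  change ‖inner ℂ u (conjugateOp α η x)‖ ≤ _
  rw [hA, inner_sub_right, inner_sum, add_mul, Finset.sum_mul]
  refine (norm_sub_le _ _).trans (add_le_add ((norm_sum_le _ _).trans
    (Finset.sum_le_sum fun j _ => ?_)) ?_)
  · rw [inner_position (hv j) (hψ j)]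
    refine (norm_inner_le_norm _ _).trans (mul_le_mul_of_nonneg_left ?_ (norm_nonneg _))
    simpa using hψn j
  · rw [mul_assoc]
    exact (norm_inner_le_norm _ _).trans (mul_le_mul_of_nonneg_left hβn (norm_nonneg _))

end WeightedSpace

end MasslessDirac

end

open MasslessDirac in
theorem proposition3p3 (n N : ℕ) (hn : 2 ≤ n) (hN : N = 2 ^ ((n + 1) / 2))
    (α : Fin (n + 1) → Matrix (Fin N) (Fin N) ℂ) (hα : IsDiracSystem α)
    (η : EuclideanSpace ℝ (Fin n) → ℝ) (h : ℝ → ℝ) (hη : IsCutoff η h) :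
    (conjugateOp α η).domain = D0 n N ∧
      IsEssentiallySelfAdjoint (conjugateOp α η) ∧
      weightedL2 n N 1 ≤ (conjugateOp α η).closure.domain := by
  have hn' : 0 < n := by omega
  have hdom := conjugateOp_domain (N := N) (α := α) hη hn'
  have hdense : Dense ((conjugateOp α η).domain : Set (L2 n N)) := by
    rw [hdom]; exact dense_D0 hn'
  have hsymm := conjugateOp_isFormalAdjoint hα hη hn'
  have hcl := conjugateOp_closure_eq_adjoint hα hη hn'
  refine ⟨hdom, ⟨hdense, hsymm, isSelfAdjoint_closure hdense hsymm hcl⟩, ?_⟩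
  rw [hcl]
  exact weightedL2_le_adjoint_domain hα hη hn'
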